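/- Let $N\ge 1$ and let $\mathbb{C}P^N$ be the complex projective space with the Fubini--Study metric. For a holomorphic map $f\colon\mathbb{C}\to\mathbb{C}P^N$, let $|df|(z)\ge 0$ be its local Lipschitz constant at $z=x+y\sqrt{-1}$, given by $$|df|^2(z)=\frac{1}{4\pi}\left(\frac{\partial^2}{\partial x^2}+\frac{\partial^2}{\partial y^2}\right)\log\left(|f_0(z)|^2+|f_1(z)|^2+\cdots+|f_N(z)|^2\right),$$ where $f=[f_0:f_1:\cdots:f_N]$ is any representation of $f$ near $z$ by holomorphic functions without common zeros. A *Brody curve* is a holomorphic map $f\colon\mathbb{C}\to\mathbb{C}P^N$ with $|df|(z)\le 1$ for all $z\in\mathbb{C}$. A holomorphic map $f\colon \mathbb{C}\to\mathbb{C}P^N$ is *nondegenerate* if there is $R>0$ such that $\max_{|z-a|\le R}|df|(z)\ge 1/R$ for all $a\in\mathbb{C}$. For every Brody curve $f$ the limit $$\rho(f)=\lim_{R\to\infty}\left(\sup_{a\in\mathbb{C}}\frac{1}{\pi R^2}\int_{|z-a|<R}|df|^2(z)\,dx\,dy\right)$$ exists (in $\mathbb{R}$), and the values $\rho(f)$ are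 bounded above, so that their supremum $\rho(\mathbb{C}P^N)=\sup\{\rho(f) : f \text{ is a Brody curve in } \mathbb{C}P^N\}$ is finite. Moreover, for every $\varepsilon>0$ there exists a nondegenerate Brody curve $g\colon\mathbb{C}\to\mathbb{C}P^N$ satisfying $$\rho(g)>\rho(\mathbb{C}P^N)-\varepsilon.$$ -/

import Mathlib

open Topology Filter MeasureTheory

noncomputable section

/-- Complex projective space `ℂP^N`, with homogeneous coordinates indexed by `0, …, N`. -/
abbrev CP (N : ℕ) : Type := Projectivization ℂ (Fin (N + 1) → ℂ)

/-- `F = (F₀, …, F_N)` is a holomorphic homogeneous coordinate representation of `f` near `z₀`: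
it is holomorphic near `z₀`, and `F z ≠ 0` and `f z = [F₀ z : ⋯ : F_N z]` for all `z` near `z₀`. -/
def IsLiftAt {N : ℕ} (f : ℂ → CP N) (z₀ : ℂ) (F : ℂ → Fin (N + 1) → ℂ) : Prop :=
  AnalyticAt ℂ F z₀ ∧ ∀ᶠ z in 𝓝 z₀, ∃ h : F z ≠ 0, f z = Projectivization.mk ℂ (F z) h

/-- A map `ℂ → ℂP^N` is holomorphic if near every point it is given by holomorphic homogeneous
coordinates without common zeros. -/
def IsHolomorphicCurve {N : ℕ} (f : ℂ → CP N) : Prop :=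
  ∀ z₀ : ℂ, ∃ F : ℂ → Fin (N + 1) → ℂ, IsLiftAt f z₀ F

/-- The quantity `(1 / 4π) (∂²/∂x² + ∂²/∂y²) log (|F₀|² + ⋯ + |F_N|²)` at the point `z`. -/
def energyOfLift {N : ℕ} (F : ℂ → Fin (N + 1) → ℂ) (z : ℂ) : ℝ :=
  1 / (4 * Real.pi) *
    Laplacian.laplacian (fun w : ℂ => Real.log (∑ i, ‖F w i‖ ^ 2)) z

open Classical in
/-- The local Lipschitz constant `|df|(z)` of `f : ℂ → ℂP^N` with respect to the Fubini–Study
metric: the nonnegative square root of `(1 / 4π) Δ log (|F₀|² + ⋯ + |F_N|²)`, where `F` is any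
holomorphic homogeneous coordinate representation of `f` near `z` (see `localLip_eq` for the
independence of the choice). -/
def localLip {N : ℕ} (f : ℂ → CP N) (z : ℂ) : ℝ :=
  if h : ∃ F : ℂ → Fin (N + 1) → ℂ, IsLiftAt f z F then √(energyOfLift h.choose z) else 0

/-- Two holomorphic representations of the same map give the same value of
`(1 / 4π) Δ log (|F₀|² + ⋯ + |F_N|²)`. -/
theorem energyOfLift_eq {N : ℕ} {f : ℂ → CP N} {z₀ : ℂ} {F G : ℂ → Fin (N + 1) → ℂ}
    (hF : IsLiftAt f z₀ F) (hG : IsLiftAt f z₀ G) : energyOfLift F z₀ = energyOfLift G z₀ := by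
  obtain ⟨hFa, hFe⟩ := hF
  obtain ⟨hGa, hGe⟩ := hG
  obtain ⟨hF0, -⟩ := hFe.self_of_nhds
  obtain ⟨i, hi⟩ := Function.ne_iff.1 hF0
  have hFi : ∀ j, AnalyticAt ℂ (fun z => F z j) z₀ := fun j => (analyticAt_pi_iff.1 hFa) j
  have hGi : ∀ j, AnalyticAt ℂ (fun z => G z j) z₀ := fun j => (analyticAt_pi_iff.1 hGa) j
  have hi' : F z₀ i ≠ 0 := hi
  have key : ∀ᶠ z in 𝓝 z₀, F z i ≠ 0 ∧ G z i ≠ 0 ∧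
      ∀ j, G z j = (G z i / F z i) * F z j := by
    filter_upwards [hFe, hGe, (hFi i).continuousAt.eventually_ne hi'] with z h1 h2 h3
    obtain ⟨h1, h1'⟩ := h1
    obtain ⟨h2, h2'⟩ := h2
    obtain ⟨a, ha⟩ := (Projectivization.mk_eq_mk_iff ℂ _ _ h2 h1).1 (h2'.symm.trans h1')
    have hc : ∀ j, G z j = (a : ℂ) * F z j := fun j => by rw [← ha]; rfl
    refine ⟨h3, ?_, fun j => ?_⟩
    · rw [hc i]; exact mul_ne_zero a.ne_zero h3
    · rw [hc i, hc j]; field_simp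
  have hq : AnalyticAt ℂ (fun z => G z i / F z i) z₀ := (hGi i).div (hFi i) hi'
  obtain ⟨-, hgi, -⟩ := key.self_of_nhds
  have hharm : InnerProductSpace.HarmonicAt (fun z => Real.log ‖G z i / F z i‖) z₀ :=
    hq.harmonicAt_log_norm (div_ne_zero hgi hi')
  have hS : ∀ j, ContDiffAt ℝ 2 (fun z => ‖F z j‖ ^ 2) z₀ := fun j =>
    (((hFi j).contDiffAt (n := 2)).restrict_scalars ℝ).norm_sq ℝ
  have hpos : ∀ z, F z i ≠ 0 → ∑ j, ‖F z j‖ ^ 2 ≠ 0 := fun z hz =>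
    (lt_of_lt_of_le (by positivity : 0 < ‖F z i‖ ^ 2)
      (Finset.single_le_sum (f := fun j => ‖F z j‖ ^ 2) (fun j _ => by positivity)
        (Finset.mem_univ i))).ne'
  have hL : ContDiffAt ℝ 2 (fun z => Real.log (∑ j, ‖F z j‖ ^ 2)) z₀ :=
    (ContDiffAt.sum fun j _ => hS j).log (hpos z₀ hi')
  have hE : (fun z => Real.log (∑ j, ‖G z j‖ ^ 2)) =ᶠ[𝓝 z₀]
      (fun z => Real.log (∑ j, ‖F z j‖ ^ 2)) +
        (2 : ℝ) • (fun z => Real.log ‖G z i / F z i‖) := by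
    filter_upwards [key] with z hz
    obtain ⟨h1, h2, h3⟩ := hz
    have h4 : ∑ j, ‖G z j‖ ^ 2 = ‖G z i / F z i‖ ^ 2 * ∑ j, ‖F z j‖ ^ 2 := by
      rw [Finset.mul_sum]
      refine Finset.sum_congr rfl fun j _ => ?_
      conv_lhs => rw [h3 j, norm_mul, mul_pow]
    have h5 : ‖G z i / F z i‖ ^ 2 ≠ 0 := pow_ne_zero _ (norm_ne_zero_iff.2 (div_ne_zero h2 h1))
    rw [h4, Real.log_mul h5 (hpos z h1), Real.log_pow]
    simp only [Pi.add_apply, Pi.smul_apply, smul_eq_mul]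
    push_cast
    ring
  have h0 := hharm.2.self_of_nhds
  have h2c : ContDiffAt ℝ 2 ((2 : ℝ) • fun z => Real.log ‖G z i / F z i‖) z₀ :=
    hharm.1.const_smul (2 : ℝ)
  unfold energyOfLift
  rw [(InnerProductSpace.laplacian_congr_nhds hE).self_of_nhds, hL.laplacian_add h2c,
    InnerProductSpace.laplacian_smul (2 : ℝ) hharm.1, h0]
  simp

theorem localLip_eq {N : ℕ} {f : ℂ → CP N} {z : ℂ} {F : ℂ → Fin (N + 1) → ℂ}
    (hF : IsLiftAt f z F) : localLip f z = √(energyOfLift F z) := by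
  have h : ∃ F : ℂ → Fin (N + 1) → ℂ, IsLiftAt f z F := ⟨F, hF⟩
  rw [localLip, dif_pos h, energyOfLift_eq h.choose_spec hF]

/-- A Brody curve: a holomorphic map `f : ℂ → ℂP^N` with `|df| ≤ 1` everywhere. -/
def IsBrodyCurve {N : ℕ} (f : ℂ → CP N) : Prop :=
  IsHolomorphicCurve f ∧ ∀ z : ℂ, localLip f z ≤ 1

/-- `f` is `R`-nondegenerate: every closed disk of radius `R` contains a point `z` with
`|df|(z) ≥ 1 / R`. -/
def IsNondegenerateWith {N : ℕ} (R : ℝ) (f : ℂ → CP N) : Prop :=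
  ∀ a : ℂ, ∃ z ∈ Metric.closedBall a R, 1 / R ≤ localLip f z

/-- `f` is nondegenerate: it is `R`-nondegenerate for some `R > 0`. -/
def IsNondegenerate {N : ℕ} (f : ℂ → CP N) : Prop :=
  ∃ R : ℝ, 0 < R ∧ IsNondegenerateWith R f

/-- `sup_{a ∈ ℂ} (1 / π R²) ∫_{|z - a| < R} |df|² dx dy`. -/
def maxMeanEnergy {N : ℕ} (f : ℂ → CP N) (R : ℝ) : ℝ :=
  ⨆ a : ℂ, 1 / (Real.pi * R ^ 2) * ∫ z in Metric.ball a R, localLip f z ^ 2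

/-- The energy density `ρ(f) = lim_{R → ∞} sup_{a ∈ ℂ} (1 / π R²) ∫_{|z - a| < R} |df|² dx dy`. -/
def energyDensity {N : ℕ} (f : ℂ → CP N) : ℝ :=
  limUnder atTop (maxMeanEnergy f)

/-- `ρ(ℂP^N)`, the supremum of `ρ(f)` over all Brody curves `f : ℂ → ℂP^N`. -/
def energyDensityCP (N : ℕ) : ℝ :=
  sSup {r : ℝ | ∃ f : ℂ → CP N, IsBrodyCurve f ∧ energyDensity f = r}

end

/-!
The mean of `|df|²` over a disk of radius `R` is dominated, up to a factor `(1 + r / R)²`, by the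
supremum of its means over the disks of radius `r`, by Fubini. Hence the suprema converge to their
infimum as `R → ∞`.

A Brody curve of nearly maximal energy density is first slowed down to `z ↦ f ((1 - δ) z)`, which
costs little density. Then one applies to its homogeneous coordinates the meromorphic operator
`1 + ∑ 8 (z - p)⁻³ ⟨u_p, ·⟩ v_p`, summed over those points `p` of a wide square lattice around
which the curve is slow; here the unit vector `u_p` spans the line `f p` and the unit vector `v_p`
is orthogonal to it. Away from these points the operator is `C¹`-close to the identity by Cauchy's
estimate, so `|df|` changes by at most `δ`. Near `p` the curve is almost constant, and the new curve
is close to `t ↦ [t³ u_p + 8 v_p]` with `t = z - p`, for which `|df|` is less than `1` everywhere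
and does not vanish at `t = 2`. So the new curve is a Brody curve of nearly the same density, and it
is nondegenerate: near each lattice point either the old curve was fast or a pole was inserted.
-/

noncomputable section

section FubiniStudySpeed

variable {V : Type*} [NormedAddCommGroup V] [InnerProductSpace ℂ V]

/-- The norm of the component of `y` orthogonal to `x`, relative to the norm of `x`: the speed, in
the Fubini–Study metric scaled by `√π`, of a curve in projective space that has a lift with value
`x` and derivative `y`. -/
def fsSpeed (x y : V) : ℝ := ‖(ℂ ∙ x)ᗮ.starProjection y‖ / ‖x‖

theorem starProjection_orthogonal_singleton_apply (x y : V) :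
    (ℂ ∙ x)ᗮ.starProjection y = y - (inner ℂ x y / ((‖x‖ ^ 2 : ℝ) : ℂ)) • x := by
  rw [Submodule.starProjection_orthogonal_val, Submodule.starProjection_singleton]
  rfl

theorem fsSpeed_nonneg (x y : V) : 0 ≤ fsSpeed x y := by unfold fsSpeed; positivity

theorem fsSpeed_smul_right (c : ℂ) (x y : V) : fsSpeed x (c • y) = ‖c‖ * fsSpeed x y := by
  rw [fsSpeed, fsSpeed, map_smul, norm_smul, mul_div_assoc]

theorem fsSpeed_le_norm_div (x y : V) : fsSpeed x y ≤ ‖y‖ / ‖x‖ :=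
  div_le_div_of_nonneg_right ((ℂ ∙ x)ᗮ.norm_starProjection_apply_le y) (norm_nonneg x)

theorem fsSpeed_sub_smul (x y : V) (c : ℂ) : fsSpeed x (y - c • x) = fsSpeed x y := by
  have hx : (ℂ ∙ x)ᗮ.starProjection x = 0 :=
    Submodule.starProjection_orthogonalComplement_singleton_eq_zero x
  rw [fsSpeed, fsSpeed, map_sub, map_smul, hx, smul_zero, sub_zero]

theorem exists_fsSpeed_eq (x y : V) : ∃ c : ℂ, fsSpeed x y = ‖y - c • x‖ / ‖x‖ :=
  ⟨_, by rw [fsSpeed, starProjection_orthogonal_singleton_apply]⟩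

theorem fsSpeed_sq {x : V} (hx : x ≠ 0) (y : V) :
    fsSpeed x y ^ 2 = (‖x‖ ^ 2 * ‖y‖ ^ 2 - ‖inner ℂ x y‖ ^ 2) / ‖x‖ ^ 4 := by
  have hx' : ‖x‖ ≠ 0 := norm_ne_zero_iff.2 hx
  have pythagoras := Submodule.norm_sq_eq_add_norm_sq_starProjection y (ℂ ∙ x)
  rw [Submodule.starProjection_singleton, norm_smul, norm_div, norm_algebraMap',
    norm_pow, norm_norm] at pythagoras
  rw [fsSpeed, div_pow, pythagoras]
  field_simp
  ring

variable {B B' : V →L[ℂ] V} {x y : V} {a b β : ℝ}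

/-- If `x`, `y` are the value and derivative of `G`, and `B`, `B'` those of an operator-valued `𝓑`,
then `B x` and `B y + B' x` are the value and derivative of `𝓑 G`. -/
theorem fsSpeed_apply_le (hx : x ≠ 0) (ha : 0 < a) (hlower : ∀ v, a * ‖v‖ ≤ ‖B v‖)
    (hupper : ∀ v, ‖B v‖ ≤ b * ‖v‖) (hB' : ‖B'‖ ≤ β) :
    fsSpeed (B x) (B y + B' x) ≤ (b * fsSpeed x y + β) / a := by
  have hx' : 0 < ‖x‖ := norm_pos_iff.2 hx
  obtain ⟨c, hc⟩ := exists_fsSpeed_eq x y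
  have hBx : 0 < a * ‖x‖ := mul_pos ha hx'
  have hnum : ‖B y + B' x - c • B x‖ ≤ b * ‖y - c • x‖ + β * ‖x‖ := by
    rw [add_sub_right_comm, ← map_smul, ← map_sub]
    exact (norm_add_le _ _).trans (add_le_add (hupper _) (B'.le_of_opNorm_le hB' x))
  calc fsSpeed (B x) (B y + B' x)
      = fsSpeed (B x) (B y + B' x - c • B x) := (fsSpeed_sub_smul _ _ c).symm
    _ ≤ ‖B y + B' x - c • B x‖ / ‖B x‖ := fsSpeed_le_norm_div _ _
    _ ≤ (b * ‖y - c • x‖ + β * ‖x‖) / (a * ‖x‖) :=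
      div_le_div₀ ((norm_nonneg _).trans hnum) hnum hBx (hlower x)
    _ = (b * fsSpeed x y + β) / a := by rw [hc]; field_simp

theorem le_fsSpeed_apply (hx : x ≠ 0) (ha : 0 < a) (hlower : ∀ v, a * ‖v‖ ≤ ‖B v‖)
    (hupper : ∀ v, ‖B v‖ ≤ b * ‖v‖) (hB' : ‖B'‖ ≤ β) :
    (a * fsSpeed x y - β) / b ≤ fsSpeed (B x) (B y + B' x) := by
  have hx' : 0 < ‖x‖ := norm_pos_iff.2 hx
  have hBx : 0 < ‖B x‖ := (mul_pos ha hx').trans_le (hlower x)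
  have hb : 0 < b := pos_of_mul_pos_left (hBx.trans_le (hupper x)) hx'.le
  obtain ⟨c, hc⟩ := exists_fsSpeed_eq (B x) (B y + B' x)
  have hspeed : fsSpeed x y * ‖x‖ ≤ ‖y - c • x‖ := by
    rw [← le_div_iff₀ hx', ← fsSpeed_sub_smul x y c]
    exact fsSpeed_le_norm_div _ _
  have hnum : a * ‖y - c • x‖ ≤ ‖B y + B' x - c • B x‖ + β * ‖x‖ := by
    have heq : B (y - c • x) = (B y + B' x - c • B x) - B' x := by
      rw [map_sub, map_smul]; abel
    calc a * ‖y - c • x‖ ≤ ‖B (y - c • x)‖ := hlower _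
      _ ≤ ‖B y + B' x - c • B x‖ + ‖B' x‖ := heq ▸ norm_sub_le _ _
      _ ≤ ‖B y + B' x - c • B x‖ + β * ‖x‖ := by gcongr; exact B'.le_of_opNorm_le hB' x
  rw [eq_div_iff hBx.ne'] at hc
  rw [div_le_iff₀ hb]
  refine le_of_mul_le_mul_right ?_ hx'
  calc (a * fsSpeed x y - β) * ‖x‖ = a * (fsSpeed x y * ‖x‖) - β * ‖x‖ := by ring
    _ ≤ a * ‖y - c • x‖ - β * ‖x‖ := by gcongr
    _ ≤ fsSpeed (B x) (B y + B' x) * ‖B x‖ := by linarith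
    _ ≤ fsSpeed (B x) (B y + B' x) * (b * ‖x‖) := by
      gcongr
      exacts [fsSpeed_nonneg _ _, hupper x]
    _ = fsSpeed (B x) (B y + B' x) * b * ‖x‖ := by ring

theorem one_sub_mul_norm_le_norm_apply (hB : ‖B - 1‖ ≤ β) (v : V) : (1 - β) * ‖v‖ ≤ ‖B v‖ := by
  have h : ‖B v - v‖ ≤ β * ‖v‖ := (B - 1).le_of_opNorm_le hB v
  linarith [norm_sub_norm_le v (B v), norm_sub_rev v (B v)]

theorem norm_apply_le_one_add_mul_norm (hB : ‖B - 1‖ ≤ β) (v : V) : ‖B v‖ ≤ (1 + β) * ‖v‖ := by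
  have h : ‖B v - v‖ ≤ β * ‖v‖ := (B - 1).le_of_opNorm_le hB v
  linarith [norm_sub_norm_le (B v) v]

theorem abs_fsSpeed_apply_sub_le (hx : x ≠ 0) (hB : ‖B - 1‖ ≤ β) (hB' : ‖B'‖ ≤ β)
    (hβ : β ≤ 1 / 2) (hs : fsSpeed x y ≤ 2) :
    |fsSpeed (B x) (B y + B' x) - fsSpeed x y| ≤ 10 * β := by
  have hβ0 : 0 ≤ β := (norm_nonneg _).trans hB
  have hpos : 0 < 1 - β := by linarith
  have hupper := fsSpeed_apply_le (y := y) hx hpos (one_sub_mul_norm_le_norm_apply hB)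
    (norm_apply_le_one_add_mul_norm hB) hB'
  have hlower := le_fsSpeed_apply (y := y) hx hpos (one_sub_mul_norm_le_norm_apply hB)
    (norm_apply_le_one_add_mul_norm hB) hB'
  rw [le_div_iff₀ hpos] at hupper
  rw [div_le_iff₀ (by linarith)] at hlower
  rw [abs_le]
  constructor <;> nlinarith [fsSpeed_nonneg x y]

end FubiniStudySpeed

theorem fderiv_fderiv_log_apply_apply {E : Type*} [NormedAddCommGroup E] [NormedSpace ℝ E]
    {φ : E → ℝ} {x : E} (hφ : ContDiffAt ℝ 2 φ x) (hx : φ x ≠ 0) (v : E) :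
    fderiv ℝ (fderiv ℝ fun y => Real.log (φ y)) x v v =
      fderiv ℝ (fderiv ℝ φ) x v v / φ x - (fderiv ℝ φ x v / φ x) ^ 2 := by
  have hev : fderiv ℝ (fun y => Real.log (φ y)) =ᶠ[𝓝 x] fun y => (φ y)⁻¹ • fderiv ℝ φ y := by
    filter_upwards [hφ.eventually (by simp), hφ.continuousAt.eventually_ne hx] with y hy hy0
    exact fderiv.log (hy.differentiableAt two_ne_zero) hy0
  have hd : HasFDerivAt φ (fderiv ℝ φ x) x := (hφ.differentiableAt two_ne_zero).hasFDerivAt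
  have hd2 : HasFDerivAt (fderiv ℝ φ) (fderiv ℝ (fderiv ℝ φ) x) x :=
    ((hφ.fderiv_right (m := 1) (by norm_num)).differentiableAt one_ne_zero).hasFDerivAt
  have hinv : HasFDerivAt (fun y => (φ y)⁻¹) (-(φ x ^ 2)⁻¹ • fderiv ℝ φ x) x :=
    (hasDerivAt_inv hx).comp_hasFDerivAt x hd
  rw [hev.fderiv_eq, (hinv.fun_smul hd2).fderiv]
  simp only [add_apply, smul_apply, smul_eq_mul,
    ContinuousLinearMap.smulRight_apply]
  field_simp
  ring

section HolomorphicVectorFunctions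

variable {V : Type*} [NormedAddCommGroup V] [InnerProductSpace ℂ V] {G H : ℂ → V} {z : ℂ}

theorem fderiv_re_inner_apply (hG : DifferentiableAt ℂ G z) (hH : DifferentiableAt ℂ H z) (v : ℂ) :
    fderiv ℝ (fun w => (inner ℂ (G w) (H w)).re) z v =
      (v * inner ℂ (G z) (deriv H z)).re + (v * inner ℂ (H z) (deriv G z)).re := by
  have hGr := hG.hasDerivAt.hasFDerivAt.restrictScalars ℝ
  have hHr := hH.hasDerivAt.hasFDerivAt.restrictScalars ℝ
  have h : HasFDerivAt (fun w => (inner ℂ (G w) (H w)).re) _ z :=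
    Complex.reCLM.hasFDerivAt.comp z (hGr.inner ℂ hHr)
  rw [h.fderiv]
  simp only [ContinuousLinearMap.comp_apply, fderivInnerCLM_apply, ContinuousLinearMap.prod_apply,
    ContinuousLinearMap.coe_restrictScalars', Complex.reCLM_apply, Complex.add_re,
    ContinuousLinearMap.toSpanSingleton_apply]
  rw [← inner_conj_symm (v • deriv G z), Complex.conj_re, inner_smul_right, inner_smul_right]

theorem fderiv_norm_sq_comp_apply (hG : DifferentiableAt ℂ G z) (v : ℂ) :
    fderiv ℝ (fun w => ‖G w‖ ^ 2) z v = 2 * (v * inner ℂ (G z) (deriv G z)).re := by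
  have hself : (fun w => ‖G w‖ ^ 2) = fun w => (inner ℂ (G w) (G w)).re :=
    funext fun w => (inner_self_eq_norm_sq (𝕜 := ℂ) (G w)).symm
  rw [hself, fderiv_re_inner_apply hG hG, two_mul]

theorem contDiffAt_norm_sq_comp [CompleteSpace V] (hG : AnalyticAt ℂ G z) :
    ContDiffAt ℝ 2 (fun w => ‖G w‖ ^ 2) z := by
  let _ : InnerProductSpace ℝ V := InnerProductSpace.rclikeToReal ℂ V
  exact (hG.contDiffAt.restrict_scalars ℝ).norm_sq ℝ

theorem fderiv_fderiv_norm_sq_comp_apply_apply [CompleteSpace V] (hG : AnalyticAt ℂ G z) (v : ℂ) :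
    fderiv ℝ (fderiv ℝ fun w => ‖G w‖ ^ 2) z v v =
      2 * (‖v‖ ^ 2 * ‖deriv G z‖ ^ 2 + (v ^ 2 * inner ℂ (G z) (deriv (deriv G) z)).re) := by
  have hd2 : DifferentiableAt ℝ (fderiv ℝ fun w => ‖G w‖ ^ 2) z :=
    ((contDiffAt_norm_sq_comp hG).fderiv_right (m := 1) (by norm_num)).differentiableAt one_ne_zero
  have hev : (fun w => fderiv ℝ (fun w => ‖G w‖ ^ 2) w v) =ᶠ[𝓝 z]
      fun w => 2 * (inner ℂ (G w) (v • deriv G w)).re := by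
    filter_upwards [hG.eventually_analyticAt] with w hw
    rw [fderiv_norm_sq_comp_apply hw.differentiableAt, inner_smul_right]
  have happly : fderiv ℝ (fderiv ℝ fun w => ‖G w‖ ^ 2) z v v =
      fderiv ℝ (fun w => fderiv ℝ (fun w => ‖G w‖ ^ 2) w v) z v := by
    rw [fderiv_clm_apply hd2 (differentiableAt_const v)]
    simp
  have hG' := hG.deriv.differentiableAt
  have hderiv : v * inner ℂ (v • deriv G z) (deriv G z) =
      ((‖v‖ ^ 2 * ‖deriv G z‖ ^ 2 : ℝ) : ℂ) := by
    rw [inner_smul_left, inner_self_eq_norm_sq_to_K, ← mul_assoc, Complex.mul_conj,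
      Complex.normSq_eq_norm_sq]
    simp
  have hline := fderiv_re_inner_apply hG.differentiableAt (hG'.const_smul v) v
  rw [Pi.smul_def, deriv_fun_const_smul v hG', hderiv, inner_smul_right, ← mul_assoc, ← sq,
    Complex.ofReal_re] at hline
  have hdre : DifferentiableAt ℝ (fun w => (inner ℂ (G w) (v • deriv G w)).re) z :=
    Complex.reCLM.differentiableAt.comp z ((hG.differentiableAt.restrictScalars ℝ).inner ℂ
      ((hG'.const_smul v).restrictScalars ℝ))
  rw [happly, hev.fderiv_eq, fderiv_const_mul hdre, smul_apply, hline,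
    smul_eq_mul, add_comm]

theorem laplacian_log_norm_sq [CompleteSpace V] (hG : AnalyticAt ℂ G z) (h0 : G z ≠ 0) :
    Laplacian.laplacian (fun w => Real.log (‖G w‖ ^ 2)) z =
      4 * fsSpeed (G z) (deriv G z) ^ 2 := by
  have h0' : ‖G z‖ ≠ 0 := norm_ne_zero_iff.2 h0
  have hsecond := fderiv_fderiv_log_apply_apply (contDiffAt_norm_sq_comp hG) (pow_ne_zero 2 h0')
  rw [InnerProductSpace.laplacian_eq_iteratedFDeriv_complexPlane]
  simp only [iteratedFDeriv_two_apply, Matrix.cons_val_zero, Matrix.cons_val_one, hsecond,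
    fderiv_fderiv_norm_sq_comp_apply_apply hG, fderiv_norm_sq_comp_apply hG.differentiableAt]
  rw [fsSpeed_sq h0, ← Complex.normSq_eq_norm_sq (inner ℂ (G z) (deriv G z)),
    Complex.normSq_apply]
  simp only [norm_one, Complex.norm_I, Complex.I_sq, Complex.mul_re, Complex.one_re,
    Complex.one_im, Complex.I_re, Complex.I_im, one_pow, Complex.neg_re, Complex.neg_im]
  field_simp
  ring

theorem analyticAt_inner_left (u : V) (hG : AnalyticAt ℂ G z) :
    AnalyticAt ℂ (fun w => inner ℂ u (G w)) z :=
  (innerSL ℂ u).analyticAt (G z) |>.comp hG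

theorem differentiableAt_cos_sq [CompleteSpace V] (u : V) (hG : AnalyticAt ℂ G z) (h0 : G z ≠ 0) :
    DifferentiableAt ℝ (fun w => ‖inner ℂ u (G w)‖ ^ 2 / ‖G w‖ ^ 2) z :=
  ((contDiffAt_norm_sq_comp (analyticAt_inner_left u hG)).div (contDiffAt_norm_sq_comp hG)
    (pow_ne_zero 2 (norm_ne_zero_iff.2 h0))).differentiableAt two_ne_zero

theorem fderiv_cos_sq_apply [CompleteSpace V] (u : V) (hG : AnalyticAt ℂ G z) (h0 : G z ≠ 0)
    (v : ℂ) :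
    fderiv ℝ (fun w => ‖inner ℂ u (G w)‖ ^ 2 / ‖G w‖ ^ 2) z v =
      2 * (v * inner ℂ (inner ℂ u (G z))
        (inner ℂ u ((ℂ ∙ G z)ᗮ.starProjection (deriv G z)))).re / ‖G z‖ ^ 2 := by
  have hα := analyticAt_inner_left u hG
  have h0' : ‖G z‖ ≠ 0 := norm_ne_zero_iff.2 h0
  have hproduct : (fun w => ‖G w‖ ^ 2 * (‖inner ℂ u (G w)‖ ^ 2 / ‖G w‖ ^ 2)) =ᶠ[𝓝 z]
      fun w => ‖inner ℂ u (G w)‖ ^ 2 := by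
    filter_upwards [hG.continuousAt.eventually_ne h0] with w hw
    exact mul_div_cancel₀ _ (pow_ne_zero 2 (norm_ne_zero_iff.2 hw))
  have hleibniz := congrArg (fun T : ℂ →L[ℝ] ℝ => T v) hproduct.fderiv_eq
  rw [fderiv_fun_mul ((contDiffAt_norm_sq_comp hG).differentiableAt two_ne_zero)
    (differentiableAt_cos_sq u hG h0)] at hleibniz
  have hderiv : deriv (fun w => inner ℂ u (G w)) z = inner ℂ u (deriv G z) :=
    ((innerSL ℂ u).hasFDerivAt.comp_hasDerivAt z hG.differentiableAt.hasDerivAt).deriv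
  have hself : inner ℂ (inner ℂ u (G z)) (inner ℂ u (G z)) =
      ((‖(inner ℂ u (G z) : ℂ)‖ ^ 2 : ℝ) : ℂ) := by
    rw [inner_self_eq_norm_sq_to_K]; norm_cast
  have hproj : v * inner ℂ (inner ℂ u (G z))
        (inner ℂ u ((ℂ ∙ G z)ᗮ.starProjection (deriv G z))) =
      v * inner ℂ (inner ℂ u (G z)) (inner ℂ u (deriv G z)) -
        ((‖(inner ℂ u (G z) : ℂ)‖ ^ 2 / ‖G z‖ ^ 2 : ℝ) : ℂ) *
          (v * inner ℂ (G z) (deriv G z)) := by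
    rw [starProjection_orthogonal_singleton_apply, inner_sub_right, inner_sub_right,
      inner_smul_right, ← smul_eq_mul (a := _ / _), inner_smul_right, hself, Complex.ofReal_div]
    ring
  simp only [add_apply, smul_apply, smul_eq_mul, fderiv_norm_sq_comp_apply hα.differentiableAt,
    fderiv_norm_sq_comp_apply hG.differentiableAt, hderiv] at hleibniz
  rw [hproj, Complex.sub_re, Complex.re_ofReal_mul, eq_div_iff (pow_ne_zero 2 h0'), mul_sub,
    ← hleibniz]
  ring

theorem norm_fderiv_cos_sq_le [CompleteSpace V] {u : V} (hu : ‖u‖ ≤ 1) (hG : AnalyticAt ℂ G z)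
    (h0 : G z ≠ 0) :
    ‖fderiv ℝ (fun w => ‖inner ℂ u (G w)‖ ^ 2 / ‖G w‖ ^ 2) z‖ ≤
      2 * fsSpeed (G z) (deriv G z) := by
  refine ContinuousLinearMap.opNorm_le_bound _ (mul_nonneg two_pos.le (fsSpeed_nonneg _ _))
    fun v => ?_
  have hpos : 0 < ‖G z‖ := norm_pos_iff.2 h0
  set P := (ℂ ∙ G z)ᗮ.starProjection (deriv G z) with hP
  have hinner : ∀ x : V, ‖(inner ℂ u x : ℂ)‖ ≤ ‖x‖ := fun x =>
    (norm_inner_le_norm u x).trans (mul_le_of_le_one_left (norm_nonneg x) hu)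
  have hre : |(v * inner ℂ (inner ℂ u (G z)) (inner ℂ u P)).re| ≤ ‖v‖ * (‖G z‖ * ‖P‖) := by
    refine (Complex.abs_re_le_norm _).trans ?_
    rw [norm_mul]
    gcongr
    exact (norm_inner_le_norm _ _).trans
      (mul_le_mul (hinner _) (hinner _) (norm_nonneg _) hpos.le)
  rw [fderiv_cos_sq_apply u hG h0, Real.norm_eq_abs, abs_div, abs_mul, abs_two,
    abs_of_pos (pow_pos hpos 2), div_le_iff₀ (pow_pos hpos 2), fsSpeed, ← hP]
  calc 2 * |(v * inner ℂ (inner ℂ u (G z)) (inner ℂ u P)).re|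
      ≤ 2 * (‖v‖ * (‖G z‖ * ‖P‖)) := by gcongr
    _ = 2 * (‖P‖ / ‖G z‖) * ‖v‖ * ‖G z‖ ^ 2 := by field_simp

end HolomorphicVectorFunctions

section Lifts

theorem energyOfLift_eq_fsSpeed {N : ℕ} {G : ℂ → EuclideanSpace ℂ (Fin (N + 1))} {z : ℂ}
    (hG : AnalyticAt ℂ G z) (h0 : G z ≠ 0) :
    energyOfLift (fun w => (G w).ofLp) z = fsSpeed (G z) (deriv G z) ^ 2 / Real.pi := by
  simp only [energyOfLift, ← EuclideanSpace.norm_sq_eq]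
  rw [laplacian_log_norm_sq hG h0]
  ring

theorem continuousAt_fsSpeed {V X : Type*} [NormedAddCommGroup V] [InnerProductSpace ℂ V]
    [TopologicalSpace X] {F H : X → V} {p : X} (hF : ContinuousAt F p) (hH : ContinuousAt H p)
    (h0 : F p ≠ 0) : ContinuousAt (fun q => fsSpeed (F q) (H q)) p := by
  have hsqrt : (fun q => fsSpeed (F q) (H q)) =ᶠ[𝓝 p] fun q =>
      √((‖F q‖ ^ 2 * ‖H q‖ ^ 2 - ‖(inner ℂ (F q) (H q) : ℂ)‖ ^ 2) / ‖F q‖ ^ 4) := by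
    filter_upwards [hF.eventually_ne h0] with q hq
    rw [← fsSpeed_sq hq, Real.sqrt_sq (fsSpeed_nonneg _ _)]
  refine ContinuousAt.congr ?_ hsqrt.symm
  exact ((((hF.norm.pow 2).mul (hH.norm.pow 2)).sub ((hF.inner hH).norm.pow 2)).div
    (hF.norm.pow 4) (pow_ne_zero 4 (norm_ne_zero_iff.2 h0))).sqrt

variable {N : ℕ}

/-- A unit vector spanning the line `q`, in `ℂ^(N+1)` with its Hermitian norm (the model space of
`CP N` carries the sup norm). -/
def unitRep (q : CP N) : EuclideanSpace ℂ (Fin (N + 1)) :=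
  (‖WithLp.toLp 2 q.rep‖ : ℂ)⁻¹ • WithLp.toLp 2 q.rep

theorem norm_toLp_rep_ne_zero (q : CP N) : ‖WithLp.toLp 2 q.rep‖ ≠ 0 :=
  norm_ne_zero_iff.2 fun h => q.rep_nonzero (congrArg WithLp.ofLp h)

theorem norm_unitRep (q : CP N) : ‖unitRep q‖ = 1 := by
  rw [unitRep, norm_smul, norm_inv, Complex.norm_real, norm_norm,
    inv_mul_cancel₀ (norm_toLp_rep_ne_zero q)]

theorem unitRep_ne_zero (q : CP N) : unitRep q ≠ 0 :=
  norm_ne_zero_iff.1 (by rw [norm_unitRep]; exact one_ne_zero)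

theorem span_eq_span_unitRep_iff {x : EuclideanSpace ℂ (Fin (N + 1))} {q : CP N} :
    ℂ ∙ x = ℂ ∙ unitRep q ↔ ∃ h : x.ofLp ≠ 0, q = Projectivization.mk ℂ x.ofLp h := by
  have hn : (‖WithLp.toLp 2 q.rep‖ : ℂ) ≠ 0 := Complex.ofReal_ne_zero.2 (norm_toLp_rep_ne_zero q)
  rw [unitRep, Submodule.span_singleton_smul_eq (inv_ne_zero hn).isUnit,
    Submodule.span_singleton_eq_span_singleton]
  constructor
  · rintro ⟨a, ha⟩
    have ha' : a • x.ofLp = q.rep := congrArg WithLp.ofLp ha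
    have hx : x.ofLp ≠ 0 := fun h => q.rep_nonzero (by rw [← ha', h, smul_zero])
    exact ⟨hx, q.mk_rep.symm.trans ((Projectivization.mk_eq_mk_iff ℂ _ _ q.rep_nonzero hx).2
      ⟨a, ha'⟩)⟩
  · rintro ⟨hx, hq⟩
    obtain ⟨a, ha⟩ :=
      (Projectivization.mk_eq_mk_iff ℂ _ _ q.rep_nonzero hx).1 (q.mk_rep.trans hq)
    exact ⟨a, congrArg (WithLp.toLp 2) ha⟩

/-- A holomorphic lift of `f` near `z` with values in the Hermitian space `ℂ^(N+1)`. -/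
def IsEuclideanLiftAt (f : ℂ → CP N) (z : ℂ) (G : ℂ → EuclideanSpace ℂ (Fin (N + 1))) : Prop :=
  AnalyticAt ℂ G z ∧ ∀ᶠ w in 𝓝 z, ℂ ∙ G w = ℂ ∙ unitRep (f w)

variable {f : ℂ → CP N} {z : ℂ} {G : ℂ → EuclideanSpace ℂ (Fin (N + 1))}

theorem isLiftAt_ofLp_iff : IsLiftAt f z (fun w => (G w).ofLp) ↔ IsEuclideanLiftAt f z G := by
  refine and_congr ⟨fun h => ?_, fun h => ?_⟩
    (eventually_congr (Eventually.of_forall fun w => span_eq_span_unitRep_iff.symm))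
  · exact ((EuclideanSpace.equiv (Fin (N + 1)) ℂ).symm.toContinuousLinearMap.analyticAt _).comp h
  · exact ((EuclideanSpace.equiv (Fin (N + 1)) ℂ).toContinuousLinearMap.analyticAt _).comp h

theorem isHolomorphicCurve_iff_exists_lift :
    IsHolomorphicCurve f ↔ ∀ z, ∃ G, IsEuclideanLiftAt f z G :=
  forall_congr' fun _ => ⟨fun ⟨F, hF⟩ => ⟨fun w => WithLp.toLp 2 (F w), isLiftAt_ofLp_iff.1 hF⟩,
    fun ⟨_, hG⟩ => ⟨_, isLiftAt_ofLp_iff.2 hG⟩⟩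

theorem IsEuclideanLiftAt.ne_zero (h : IsEuclideanLiftAt f z G) : G z ≠ 0 := by
  intro h0
  have hspan := h.2.self_of_nhds
  rw [h0, Submodule.span_zero_singleton, eq_comm, Submodule.span_singleton_eq_bot] at hspan
  exact unitRep_ne_zero _ hspan

theorem IsEuclideanLiftAt.eventually (h : IsEuclideanLiftAt f z G) :
    ∀ᶠ w in 𝓝 z, IsEuclideanLiftAt f w G :=
  h.1.eventually_analyticAt.and h.2.eventually_nhds

theorem IsEuclideanLiftAt.localLip_eq (h : IsEuclideanLiftAt f z G) :
    localLip f z = fsSpeed (G z) (deriv G z) / √Real.pi := by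
  rw [_root_.localLip_eq (isLiftAt_ofLp_iff.2 h), energyOfLift_eq_fsSpeed h.1 h.ne_zero,
    Real.sqrt_div (sq_nonneg _), Real.sqrt_sq (fsSpeed_nonneg _ _)]

theorem IsEuclideanLiftAt.fsSpeed_eq (h : IsEuclideanLiftAt f z G) :
    fsSpeed (G z) (deriv G z) = √Real.pi * localLip f z := by
  rw [h.localLip_eq, mul_div_cancel₀ _ (Real.sqrt_pos.2 Real.pi_pos).ne']

theorem IsHolomorphicCurve.continuous_localLip (hf : IsHolomorphicCurve f) :
    Continuous (localLip f) := by
  rw [continuous_iff_continuousAt]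
  intro z
  obtain ⟨G, hG⟩ := isHolomorphicCurve_iff_exists_lift.1 hf z
  have heq : localLip f =ᶠ[𝓝 z] fun w => fsSpeed (G w) (deriv G w) / √Real.pi :=
    hG.eventually.mono fun w hw => hw.localLip_eq
  exact ((continuousAt_fsSpeed hG.1.continuousAt hG.1.deriv.continuousAt hG.ne_zero).div_const
    _).congr heq.symm

theorem localLip_nonneg (f : ℂ → CP N) (z : ℂ) : 0 ≤ localLip f z := by
  unfold localLip; split_ifs
  · exact Real.sqrt_nonneg _
  · exact le_rfl

end Lifts

section MaximalMeans

variable {E : Type*} [NormedAddCommGroup E] [MeasurableSpace E] {μ : Measure E} {φ ψ : E → ℝ}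
  {C r R : ℝ}

/-- The supremum of the means of `φ` over all balls of radius `R`. -/
def maxMean (μ : Measure E) (φ : E → ℝ) (R : ℝ) : ℝ := ⨆ a : E, ⨍ z in Metric.ball a R, φ z ∂μ

theorem maxMean_nonneg (h0 : ∀ z, 0 ≤ φ z) (R : ℝ) : 0 ≤ maxMean μ φ R :=
  Real.iSup_nonneg fun _ => integral_nonneg h0

theorem maxMean_const_mul {c : ℝ} (hc : 0 ≤ c) (φ : E → ℝ) (R : ℝ) :
    maxMean μ (fun z => c * φ z) R = c * maxMean μ φ R := by
  simp only [maxMean, average, integral_const_mul]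
  rw [Real.mul_iSup_of_nonneg hc]

variable [μ.IsAddHaarMeasure]

theorem setIntegral_ball_comp_add [BorelSpace E] (φ : E → ℝ) (a y : E) (R : ℝ) :
    ∫ b in Metric.ball a R, φ (b + y) ∂μ = ∫ b in Metric.ball (a + y) R, φ b ∂μ := by
  rw [← (measurePreserving_add_right μ y).setIntegral_preimage_emb
    (measurableEmbedding_addRight y) φ (Metric.ball (a + y) R), Metric.preimage_add_right_ball,
    add_sub_cancel_right]

variable [NormedSpace ℝ E] [FiniteDimensional ℝ E]

theorem measureReal_ball_pos (a : E) (hR : 0 < R) : 0 < μ.real (Metric.ball a R) :=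
  ENNReal.toReal_pos (Metric.measure_ball_pos μ a hR).ne' measure_ball_lt_top.ne

variable [BorelSpace E]

theorem integrableOn_ball_of_continuous (hφ : Continuous φ) (a : E) (R : ℝ) :
    IntegrableOn φ (Metric.ball a R) μ :=
  (hφ.continuousOn.integrableOn_compact (isCompact_closedBall a R)).mono_set
    Metric.ball_subset_closedBall

theorem setAverage_ball_le (hφ : Continuous φ) (hC : ∀ z, φ z ≤ C) (a : E) (hR : 0 < R) :
    ⨍ z in Metric.ball a R, φ z ∂μ ≤ C :=
  (convex_Iic C).set_average_mem isClosed_Iic (Metric.measure_ball_pos μ a hR).ne'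
    measure_ball_lt_top.ne (Eventually.of_forall hC) (integrableOn_ball_of_continuous hφ a R)

theorem bddAbove_range_setAverage_ball (hφ : Continuous φ) (hC : ∀ z, φ z ≤ C) (hR : 0 < R) :
    BddAbove (Set.range fun a : E => ⨍ z in Metric.ball a R, φ z ∂μ) :=
  ⟨C, Set.forall_mem_range.2 fun a => setAverage_ball_le hφ hC a hR⟩

theorem maxMean_le (hφ : Continuous φ) (hC : ∀ z, φ z ≤ C) (hR : 0 < R) : maxMean μ φ R ≤ C :=
  ciSup_le fun a => setAverage_ball_le hφ hC a hR

theorem setIntegral_ball_le_mul_maxMean (hφ : Continuous φ) (hC : ∀ z, φ z ≤ C) (a : E)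
    (hR : 0 < R) : ∫ z in Metric.ball a R, φ z ∂μ ≤ μ.real (Metric.ball a R) * maxMean μ φ R := by
  rw [← measure_smul_setAverage φ measure_ball_lt_top.ne, smul_eq_mul]
  exact mul_le_mul_of_nonneg_left (le_ciSup (bddAbove_range_setAverage_ball hφ hC hR) a)
    measureReal_nonneg

theorem integrable_uncurry_comp_add (hφ : Continuous φ) (a b : E) (r R : ℝ) :
    Integrable (Function.uncurry fun z y => φ (z + y))
      ((μ.restrict (Metric.ball a R)).prod (μ.restrict (Metric.ball b r))) := by
  rw [Measure.prod_restrict]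
  have hcont : Continuous (Function.uncurry fun z y => φ (z + y)) := hφ.comp continuous_add
  exact (hcont.continuousOn.integrableOn_compact
    ((isCompact_closedBall a R).prod (isCompact_closedBall b r))).mono_set
    (Set.prod_mono Metric.ball_subset_closedBall Metric.ball_subset_closedBall)

theorem integral_integral_ball_comp_add_le (hφ : Continuous φ) (hC : ∀ z, φ z ≤ C) (a : E)
    (hr : 0 < r) (R : ℝ) :
    ∫ b in Metric.ball a R, ∫ y in Metric.ball 0 r, φ (b + y) ∂μ ∂μ ≤
      μ.real (Metric.ball a R) * (μ.real (Metric.ball (0 : E) r) * maxMean μ φ r) := by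
  rw [← smul_eq_mul (a := μ.real (Metric.ball a R)), ← setIntegral_const]
  refine setIntegral_mono (integrable_uncurry_comp_add hφ a 0 r R).integral_prod_left
    (integrableOn_ball_of_continuous continuous_const a R) fun b => ?_
  have htranslate : ∫ y in Metric.ball 0 r, φ (b + y) ∂μ = ∫ y in Metric.ball b r, φ y ∂μ := by
    simp_rw [add_comm b]
    rw [setIntegral_ball_comp_add, zero_add]
  simp only [htranslate, ← Measure.addHaar_real_ball_center μ b r]
  exact setIntegral_ball_le_mul_maxMean hφ hC b hr

theorem mul_setIntegral_ball_le (hφ : Continuous φ) (h0 : ∀ z, 0 ≤ φ z) (a : E) (r R : ℝ) :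
    μ.real (Metric.ball (0 : E) r) * ∫ z in Metric.ball a R, φ z ∂μ ≤
      ∫ y in Metric.ball 0 r, ∫ b in Metric.ball a (R + r), φ (b + y) ∂μ ∂μ := by
  rw [← smul_eq_mul, ← setIntegral_const]
  refine setIntegral_mono_on (integrableOn_ball_of_continuous continuous_const 0 r)
    (integrable_uncurry_comp_add hφ a 0 r (R + r)).integral_prod_right
    Metric.isOpen_ball.measurableSet fun y hy => ?_
  rw [setIntegral_ball_comp_add]
  refine setIntegral_mono_set (integrableOn_ball_of_continuous hφ _ _)
    (Eventually.of_forall h0) (LE.le.eventuallyLE (Metric.ball_subset_ball' ?_))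
  rw [dist_self_add_right]
  linarith [mem_ball_zero_iff.1 hy]

theorem measureReal_ball_eq (a : E) (hR : 0 < R) :
    μ.real (Metric.ball a R) = R ^ Module.finrank ℝ E * μ.real (Metric.ball (0 : E) 1) := by
  rw [measureReal_def, Measure.addHaar_ball_of_pos μ a hR, ENNReal.toReal_mul,
    ENNReal.toReal_ofReal (pow_nonneg hR.le _), measureReal_def]

theorem maxMean_le_mul (hφ : Continuous φ) (h0 : ∀ z, 0 ≤ φ z) (hC : ∀ z, φ z ≤ C) (hr : 0 < r)
    (hR : 0 < R) : maxMean μ φ R ≤ (1 + r / R) ^ Module.finrank ℝ E * maxMean μ φ r := by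
  refine ciSup_le fun a => ?_
  have hfubini := (mul_setIntegral_ball_le (μ := μ) hφ h0 a r R).trans
    ((integral_integral_swap (integrable_uncurry_comp_add hφ a 0 r (R + r))).symm.le.trans
      (integral_integral_ball_comp_add_le hφ hC a hr (R + r)))
  rw [mul_left_comm] at hfubini
  have hint := le_of_mul_le_mul_left hfubini (measureReal_ball_pos 0 hr)
  rw [setAverage_eq, smul_eq_mul, inv_mul_le_iff₀ (measureReal_ball_pos a hR), ← mul_assoc]
  refine hint.trans_eq (congrArg (· * maxMean μ φ r) ?_)
  rw [measureReal_ball_eq a hR, measureReal_ball_eq a (add_pos hR hr), mul_right_comm, ← mul_pow,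
    mul_add, mul_one, mul_div_cancel₀ r hR.ne']

theorem exists_tendsto_maxMean (hφ : Continuous φ) (h0 : ∀ z, 0 ≤ φ z) (hC : ∀ z, φ z ≤ C) :
    ∃ l, Tendsto (maxMean μ φ) atTop (𝓝 l) := by
  have hbelow : BddBelow (maxMean μ φ '' Set.Ioi 0) :=
    ⟨0, Set.forall_mem_image.2 fun R _ => maxMean_nonneg h0 R⟩
  refine ⟨sInf (maxMean μ φ '' Set.Ioi 0), tendsto_order.2 ⟨fun x hx => ?_, fun x hx => ?_⟩⟩
  · filter_upwards [eventually_gt_atTop 0] with R hR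
    exact hx.trans_le (csInf_le hbelow ⟨R, hR, rfl⟩)
  · obtain ⟨_, ⟨r, hr, rfl⟩, hrx⟩ := exists_lt_of_csInf_lt (Set.nonempty_Ioi.image _) hx
    have hlim : Tendsto (fun R : ℝ => (1 + r / R) ^ Module.finrank ℝ E * maxMean μ φ r) atTop
        (𝓝 (maxMean μ φ r)) := by
      have := (((tendsto_const_nhds (x := r)).div_atTop tendsto_id).const_add 1).pow
        (Module.finrank ℝ E)
      simpa using this.mul_const (maxMean μ φ r)
    filter_upwards [hlim.eventually_lt_const hrx, eventually_gt_atTop 0] with R hlt hR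
    exact (maxMean_le_mul hφ h0 hC hr hR).trans_lt hlt

theorem maxMean_sub_le {δ : ℝ} (hφ : Continuous φ) (hC : ∀ z, φ z ≤ C) (hψ : Continuous ψ)
    (h : ∀ z, ψ z - δ ≤ φ z) (hR : 0 < R) : maxMean μ ψ R - δ ≤ maxMean μ φ R := by
  rw [sub_le_iff_le_add]
  refine ciSup_le fun a => ?_
  rw [← sub_le_iff_le_add]
  refine le_trans ?_ (le_ciSup (bddAbove_range_setAverage_ball hφ hC hR) a)
  have hpos := measureReal_ball_pos (μ := μ) a hR
  have hint : ∫ z in Metric.ball a R, ψ z ∂μ - μ.real (Metric.ball a R) * δ ≤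
      ∫ z in Metric.ball a R, φ z ∂μ := by
    rw [← smul_eq_mul, ← setIntegral_const, ← integral_sub
      (integrableOn_ball_of_continuous hψ a R)
      (integrableOn_ball_of_continuous continuous_const a R)]
    exact setIntegral_mono (integrableOn_ball_of_continuous (hψ.sub continuous_const) a R)
      (integrableOn_ball_of_continuous hφ a R) h
  rw [setAverage_eq, setAverage_eq, smul_eq_mul, smul_eq_mul, le_inv_mul_iff₀ hpos, mul_sub,
    mul_inv_cancel_left₀ hpos.ne']
  exact hint

open scoped Pointwise in
theorem maxMean_comp_smul {c : ℝ} (hc : 0 < c) (φ : E → ℝ) (R : ℝ) :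
    maxMean μ (fun z => φ (c • z)) R = maxMean μ φ (c * R) := by
  have hball : ∀ a : E, ⨍ z in Metric.ball a R, φ (c • z) ∂μ =
      ⨍ z in Metric.ball (c • a) (c * R), φ z ∂μ := by
    intro a
    have hsmul : Metric.ball (c • a) (c * R) = c • Metric.ball a R := by
      rw [smul_ball hc.ne', Real.norm_of_nonneg hc.le]
    rw [setAverage_eq, setAverage_eq, Measure.setIntegral_comp_smul_of_pos μ φ _ hc, hsmul,
      measureReal_def, measureReal_def, Measure.addHaar_smul_of_nonneg μ hc.le, ENNReal.toReal_mul,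
      ENNReal.toReal_ofReal (pow_nonneg hc.le _), smul_smul, mul_inv, mul_comm]
  simp only [maxMean, hball]
  exact (MulAction.surjective₀ hc.ne').iSup_comp
    fun a => ⨍ z in Metric.ball a (c * R), φ z ∂μ

end MaximalMeans

section BrodyCurves

variable {N : ℕ} {f g : ℂ → CP N}

theorem maxMeanEnergy_eq_maxMean (f : ℂ → CP N) {R : ℝ} (hR : 0 < R) :
    maxMeanEnergy f R = maxMean volume (fun z => localLip f z ^ 2) R := by
  have hvol : ∀ a : ℂ, volume.real (Metric.ball a R) = Real.pi * R ^ 2 := by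
    intro a
    rw [measureReal_def, Complex.volume_ball, ENNReal.toReal_mul, ENNReal.toReal_pow,
      ENNReal.toReal_ofReal hR.le, ENNReal.coe_toReal, NNReal.coe_real_pi, mul_comm]
  simp only [maxMeanEnergy, maxMean, setAverage_eq, hvol, one_div, smul_eq_mul]

theorem IsBrodyCurve.sq_localLip_le_one (hf : IsBrodyCurve f) (z : ℂ) : localLip f z ^ 2 ≤ 1 :=
  pow_le_one₀ (localLip_nonneg f z) (hf.2 z)

theorem IsBrodyCurve.continuous_sq_localLip (hf : IsBrodyCurve f) :
    Continuous fun z => localLip f z ^ 2 :=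
  hf.1.continuous_localLip.pow 2

theorem IsBrodyCurve.tendsto_maxMeanEnergy (hf : IsBrodyCurve f) :
    Tendsto (maxMeanEnergy f) atTop (𝓝 (energyDensity f)) := by
  obtain ⟨l, hl⟩ := exists_tendsto_maxMean (μ := volume) hf.continuous_sq_localLip
    (fun _ => sq_nonneg _) hf.sq_localLip_le_one
  refine tendsto_nhds_limUnder ⟨l, hl.congr' ?_⟩
  filter_upwards [eventually_gt_atTop 0] with R hR
  exact (maxMeanEnergy_eq_maxMean f hR).symm

theorem IsBrodyCurve.energyDensity_le_one (hf : IsBrodyCurve f) : energyDensity f ≤ 1 := by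
  refine le_of_tendsto hf.tendsto_maxMeanEnergy ?_
  filter_upwards [eventually_gt_atTop 0] with R hR
  rw [maxMeanEnergy_eq_maxMean f hR]
  exact maxMean_le hf.continuous_sq_localLip hf.sq_localLip_le_one hR

theorem IsBrodyCurve.energyDensity_sub_le (hf : IsBrodyCurve f) (hg : IsBrodyCurve g) {δ : ℝ}
    (hδ : 0 ≤ δ) (h : ∀ z, localLip f z - δ ≤ localLip g z) :
    energyDensity f - 2 * δ ≤ energyDensity g := by
  refine le_of_tendsto_of_tendsto (hf.tendsto_maxMeanEnergy.sub_const _)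
    hg.tendsto_maxMeanEnergy ?_
  filter_upwards [eventually_gt_atTop 0] with R hR
  rw [maxMeanEnergy_eq_maxMean f hR, maxMeanEnergy_eq_maxMean g hR]
  refine maxMean_sub_le hg.continuous_sq_localLip hg.sq_localLip_le_one hf.continuous_sq_localLip
    (fun z => ?_) hR
  have hf0 := localLip_nonneg f z
  have hf1 := hf.2 z
  rcases le_total (localLip f z) δ with hfδ | hfδ
  · nlinarith [sq_nonneg (localLip g z)]
  · nlinarith [h z]

theorem IsEuclideanLiftAt.comp_const_mul {G : ℂ → EuclideanSpace ℂ (Fin (N + 1))} {c z : ℂ}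
    (h : IsEuclideanLiftAt f (c * z) G) :
    IsEuclideanLiftAt (fun w => f (c * w)) z (fun w => G (c * w)) := by
  have hmul : AnalyticAt ℂ (fun w : ℂ => c * w) z := by fun_prop
  exact ⟨h.1.fun_comp hmul, hmul.continuousAt.eventually h.2⟩

theorem IsHolomorphicCurve.comp_const_mul (hf : IsHolomorphicCurve f) (c : ℂ) :
    IsHolomorphicCurve (fun w => f (c * w)) := by
  rw [isHolomorphicCurve_iff_exists_lift] at hf ⊢
  exact fun z => (hf (c * z)).imp' _ fun _ hG => hG.comp_const_mul

theorem IsHolomorphicCurve.localLip_comp_const_mul (hf : IsHolomorphicCurve f) (c z : ℂ) :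
    localLip (fun w => f (c * w)) z = ‖c‖ * localLip f (c * z) := by
  obtain ⟨G, hG⟩ := isHolomorphicCurve_iff_exists_lift.1 hf (c * z)
  rw [hG.comp_const_mul.localLip_eq, hG.localLip_eq, deriv_comp_mul_left c G z,
    fsSpeed_smul_right, mul_div_assoc]

theorem IsBrodyCurve.comp_const_mul (hf : IsBrodyCurve f) {c : ℂ} (hc : ‖c‖ ≤ 1) :
    IsBrodyCurve (fun w => f (c * w)) :=
  ⟨hf.1.comp_const_mul c, fun z => by
    rw [hf.1.localLip_comp_const_mul]
    exact mul_le_one₀ hc (localLip_nonneg _ _) (hf.2 _)⟩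

theorem IsBrodyCurve.energyDensity_comp_const_mul (hf : IsBrodyCurve f) {c : ℝ} (hc : 0 < c)
    (hc1 : c ≤ 1) : energyDensity (fun w => f (c * w)) = c ^ 2 * energyDensity f := by
  have hnorm : ‖(c : ℂ)‖ = c := Complex.norm_of_nonneg hc.le
  refine tendsto_nhds_unique (hf.comp_const_mul (hnorm.trans_le hc1)).tendsto_maxMeanEnergy
    (((hf.tendsto_maxMeanEnergy.comp (tendsto_id.const_mul_atTop hc)).const_mul _).congr' ?_)
  filter_upwards [eventually_gt_atTop 0] with R hR
  simp only [Function.comp_apply, id_eq]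
  rw [maxMeanEnergy_eq_maxMean _ (mul_pos hc hR), maxMeanEnergy_eq_maxMean _ hR,
    ← maxMean_comp_smul hc, ← maxMean_const_mul (sq_nonneg c)]
  simp only [hf.1.localLip_comp_const_mul, hnorm, mul_pow, Complex.real_smul]

theorem isBrodyCurve_const (p : CP N) : IsBrodyCurve fun _ => p := by
  have hlift : ∀ z, IsEuclideanLiftAt (fun _ => p) z fun _ => unitRep p := fun _ =>
    ⟨analyticAt_const, Eventually.of_forall fun _ => rfl⟩
  refine ⟨isHolomorphicCurve_iff_exists_lift.2 fun z => ⟨_, hlift z⟩, fun z => ?_⟩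
  rw [(hlift z).localLip_eq, deriv_const, fsSpeed, map_zero, norm_zero, zero_div, zero_div]
  exact zero_le_one

end BrodyCurves

section SquareLattice

/-- The point `L (m₀ + m₁ i)` of the square lattice of side `L`. -/
def latticePoint (L : ℝ) (m : Fin 2 → ℤ) : ℂ := ⟨L * m 0, L * m 1⟩

/-- The index of a point of the square lattice of side `L` close to `w`, found by rounding the
coordinates. -/
def nearestIndex (L : ℝ) (w : ℂ) : Fin 2 → ℤ := ![round (w.re / L), round (w.im / L)]

variable {L : ℝ} {m n : Fin 2 → ℤ} {w : ℂ}

theorem latticePoint_sub (L : ℝ) (m n : Fin 2 → ℤ) :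
    latticePoint L m - latticePoint L n = latticePoint L (m - n) := by
  apply Complex.ext <;> simp [latticePoint, mul_sub]

theorem mul_norm_le_norm_latticePoint (hL : 0 < L) (m : Fin 2 → ℤ) :
    L * ‖m‖ ≤ ‖latticePoint L m‖ := by
  rw [← le_div_iff₀' hL, pi_norm_le_iff_of_nonneg (by positivity), Fin.forall_fin_two]
  have hre := Complex.abs_re_le_norm (latticePoint L m)
  have him := Complex.abs_im_le_norm (latticePoint L m)
  simp only [latticePoint, abs_mul, abs_of_pos hL] at hre him
  rw [le_div_iff₀' hL, le_div_iff₀' hL, Int.norm_eq_abs, Int.norm_eq_abs]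
  exact ⟨hre, him⟩

theorem abs_sub_mul_round_div_le (hL : 0 < L) (x : ℝ) : |x - L * round (x / L)| ≤ L / 2 := by
  have hfactor : x - L * round (x / L) = L * (x / L - round (x / L)) := by field_simp
  rw [hfactor, abs_mul, abs_of_pos hL]
  linarith [mul_le_mul_of_nonneg_left (abs_sub_round (x / L)) hL.le]

theorem norm_sub_latticePoint_nearestIndex_le (hL : 0 < L) (w : ℂ) :
    ‖w - latticePoint L (nearestIndex L w)‖ ≤ 3 / 4 * L := by
  refine le_of_sq_le_sq ?_ (by positivity)
  rw [← Complex.normSq_eq_norm_sq, Complex.normSq_apply]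
  simp only [latticePoint, nearestIndex, Complex.sub_re, Complex.sub_im, Matrix.cons_val_zero,
    Matrix.cons_val_one]
  have hre := abs_le.1 (abs_sub_mul_round_div_le hL w.re)
  have him := abs_le.1 (abs_sub_mul_round_div_le hL w.im)
  nlinarith [sq_le_sq' hre.1 hre.2, sq_le_sq' him.1 him.2]

theorem nearestIndex_latticePoint (hL : L ≠ 0) (n : Fin 2 → ℤ) :
    nearestIndex L (latticePoint L n) = n := by
  ext i
  fin_cases i <;> simp [nearestIndex, latticePoint, hL]

theorem one_le_norm_of_ne_zero {ι : Type*} [Fintype ι] {m : ι → ℤ} (hm : m ≠ 0) : 1 ≤ ‖m‖ := by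
  obtain ⟨i, hi⟩ := Function.ne_iff.1 hm
  refine le_trans ?_ (norm_le_pi_norm m i)
  rw [Int.norm_eq_abs]
  exact_mod_cast Int.one_le_abs hi

theorem le_norm_sub_latticePoint (hL : 0 < L) (hmn : m ≠ n)
    (hw : ‖w - latticePoint L n‖ < 7 / 8 * L) : L / 8 * ‖m - n‖ ≤ ‖w - latticePoint L m‖ := by
  have hone := one_le_norm_of_ne_zero (sub_ne_zero.2 hmn)
  have hlattice := mul_norm_le_norm_latticePoint hL (m - n)
  have htriangle := norm_sub_le (w - latticePoint L n) (w - latticePoint L m)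
  rw [sub_sub_sub_cancel_left, latticePoint_sub] at htriangle
  nlinarith

theorem ne_latticePoint_of_ne (hL : 0 < L) (hmn : m ≠ n)
    (hw : ‖w - latticePoint L n‖ < 7 / 8 * L) : w ≠ latticePoint L m := by
  have hpos : 0 < L / 8 * ‖m - n‖ := by have := norm_pos_iff.2 (sub_ne_zero.2 hmn); positivity
  exact sub_ne_zero.1 (norm_pos_iff.1 (hpos.trans_le (le_norm_sub_latticePoint hL hmn hw)))

/-- The sum of `‖m‖⁻³` over the nonzero vectors of `ℤ²` with the sup norm. -/
def cubeLatticeSum : ℝ := ∑' m : Fin 2 → ℤ, ‖m‖ ^ (-3 : ℝ)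

theorem cubeLatticeSum_nonneg : 0 ≤ cubeLatticeSum :=
  tsum_nonneg fun _ => Real.rpow_nonneg (norm_nonneg _) _

theorem hasSum_norm_sub_rpow_neg_three (n : Fin 2 → ℤ) :
    HasSum (fun m : Fin 2 → ℤ => ‖m - n‖ ^ (-3 : ℝ)) cubeLatticeSum :=
  ((Equiv.subRight n).hasSum_iff (f := fun m : Fin 2 → ℤ => ‖m‖ ^ (-3 : ℝ))).2
    (EisensteinSeries.summable_one_div_norm_rpow (by norm_num)).hasSum

end SquareLattice

theorem norm_update_zero_le {ι F : Type*} [DecidableEq ι] [SeminormedAddCommGroup F] {T : ι → F}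
    {C : ℝ} (hT : ∀ m, ‖T m‖ ≤ C) (n m : ι) : ‖Function.update T n 0 m‖ ≤ C := by
  rcases eq_or_ne m n with rfl | hmn
  · rw [Function.update_self, norm_zero]
    exact (norm_nonneg _).trans (hT m)
  · rw [Function.update_of_ne hmn]
    exact hT m

section PoleSums

variable {W : Type*} [NormedAddCommGroup W] [NormedSpace ℂ W] {T : (Fin 2 → ℤ) → W} {L C : ℝ}
  {n : Fin 2 → ℤ} {w : ℂ}

/-- The sum of `(w - p)⁻³ T` over the points `p` of the square lattice of side `L`. At a lattice
point `w` the term with `p = w` is `0`, by the convention `0⁻¹ = 0`. -/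
def poleSum (T : (Fin 2 → ℤ) → W) (L : ℝ) (w : ℂ) : W :=
  ∑' m, ((w - latticePoint L m) ^ 3)⁻¹ • T m

theorem norm_pole_le (hT : ∀ m, ‖T m‖ ≤ C) (hn : T n = 0) (hL : 0 < L)
    (hw : ‖w - latticePoint L n‖ < 7 / 8 * L) (m : Fin 2 → ℤ) :
    ‖((w - latticePoint L m) ^ 3)⁻¹ • T m‖ ≤ C * (8 / L) ^ 3 * ‖m - n‖ ^ (-3 : ℝ) := by
  have hC : 0 ≤ C := (norm_nonneg _).trans (hT n)
  rcases eq_or_ne m n with rfl | hmn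
  · rw [hn, smul_zero, norm_zero]
    positivity
  · have hpos : 0 < L / 8 * ‖m - n‖ := by have := norm_pos_iff.2 (sub_ne_zero.2 hmn); positivity
    have hinv : (8 / L) ^ 3 * ‖m - n‖ ^ (-3 : ℝ) = ((L / 8 * ‖m - n‖) ^ 3)⁻¹ := by
      rw [Real.rpow_neg (norm_nonneg _), Real.rpow_ofNat, mul_pow, mul_inv, ← inv_pow (L / 8),
        inv_div]
    rw [mul_assoc, hinv, mul_comm, norm_smul, norm_inv, norm_pow]
    gcongr
    · exact le_norm_sub_latticePoint hL hmn hw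
    · exact hT m

theorem norm_poleSum_le (hT : ∀ m, ‖T m‖ ≤ C) (hn : T n = 0) (hL : 0 < L)
    (hw : ‖w - latticePoint L n‖ < 7 / 8 * L) :
    ‖poleSum T L w‖ ≤ C * (8 / L) ^ 3 * cubeLatticeSum :=
  tsum_of_norm_bounded ((hasSum_norm_sub_rpow_neg_three n).mul_left _)
    (norm_pole_le hT hn hL hw)

variable [CompleteSpace W]

theorem differentiableOn_poleSum (hT : ∀ m, ‖T m‖ ≤ C) (hn : T n = 0) (hL : 0 < L) :
    DifferentiableOn ℂ (poleSum T L) (Metric.ball (latticePoint L n) (7 / 8 * L)) := by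
  refine Complex.differentiableOn_tsum_of_summable_norm
    ((hasSum_norm_sub_rpow_neg_three n).summable.mul_left _) (fun m => ?_) Metric.isOpen_ball
    fun m w hw => norm_pole_le hT hn hL (mem_ball_iff_norm.1 hw) m
  rcases eq_or_ne m n with rfl | hmn
  · simp only [hn, smul_zero]
    exact differentiableOn_const _
  · intro w hw
    have hne := sub_ne_zero.2 (ne_latticePoint_of_ne hL hmn (mem_ball_iff_norm.1 hw))
    have hcube : DifferentiableAt ℂ (fun w => (w - latticePoint L m) ^ 3) w := by fun_prop
    exact ((hcube.inv (pow_ne_zero 3 hne)).smul_const (T m)).differentiableWithinAt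

theorem poleSum_eq_add_update (hT : ∀ m, ‖T m‖ ≤ C) (hL : 0 < L)
    (hw : ‖w - latticePoint L n‖ < 7 / 8 * L) :
    poleSum T L w =
      ((w - latticePoint L n) ^ 3)⁻¹ • T n + poleSum (Function.update T n 0) L w := by
  have hsum : Summable fun m => ((w - latticePoint L m) ^ 3)⁻¹ • Function.update T n 0 m :=
    Summable.of_norm_bounded ((hasSum_norm_sub_rpow_neg_three n).summable.mul_left _)
      (norm_pole_le (norm_update_zero_le hT n) (Function.update_self n 0 T) hL hw)
  rw [poleSum, poleSum, ← ((hasSum_ite_eq n _).add hsum.hasSum).tsum_eq]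
  refine tsum_congr fun m => ?_
  rcases eq_or_ne m n with rfl | hmn
  · simp only [if_pos, Function.update_self, smul_zero, add_zero]
  · rw [if_neg hmn, Function.update_of_ne hmn, zero_add]

theorem norm_poleSum_le_of_le_norm_sub {r : ℝ} (hT : ∀ m, ‖T m‖ ≤ C) (hL : 0 < L) (hr : 0 < r)
    (hrw : r ≤ ‖w - latticePoint L n‖) (hw : ‖w - latticePoint L n‖ < 7 / 8 * L) :
    ‖poleSum T L w‖ ≤ C / r ^ 3 + C * (8 / L) ^ 3 * cubeLatticeSum := by
  have hC : 0 ≤ C := (norm_nonneg _).trans (hT n)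
  rw [poleSum_eq_add_update hT hL hw]
  refine (norm_add_le _ _).trans (add_le_add ?_
    (norm_poleSum_le (norm_update_zero_le hT n) (Function.update_self n 0 T) hL hw))
  rw [norm_smul, norm_inv, norm_pow, inv_mul_eq_div]
  gcongr
  exact hT n

theorem analyticAt_poleSum (hT : ∀ m, ‖T m‖ ≤ C) (hL : 0 < L)
    (hw : ‖w - latticePoint L n‖ < 7 / 8 * L) (hreg : T n = 0 ∨ w ≠ latticePoint L n) :
    AnalyticAt ℂ (poleSum T L) w := by
  have hball : Metric.ball (latticePoint L n) (7 / 8 * L) ∈ 𝓝 w :=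
    Metric.isOpen_ball.mem_nhds (mem_ball_iff_norm.2 hw)
  rcases hreg with hn | hne
  · exact (differentiableOn_poleSum hT hn hL).analyticAt hball
  · have hsub : AnalyticAt ℂ (fun z => z - latticePoint L n) w := by fun_prop
    have hpole := (((hsub.fun_pow 3).fun_inv (pow_ne_zero 3 (sub_ne_zero.2 hne))).fun_smul
      (analyticAt_const (v := T n)))
    have hregular := (differentiableOn_poleSum (norm_update_zero_le hT n)
      (Function.update_self n 0 T) hL).analyticAt hball
    refine (hpole.fun_add hregular).congr ?_
    filter_upwards [hball] with z hz
    exact (poleSum_eq_add_update hT hL (mem_ball_iff_norm.1 hz)).symm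

end PoleSums

section GluingOperators

variable {V : Type*} [NormedAddCommGroup V] [NormedSpace ℂ V] {T : (Fin 2 → ℤ) → V →L[ℂ] V}
  {L C : ℝ} {n : Fin 2 → ℤ} {w : ℂ}

open Classical in
/-- The operator `1 + ∑ (w - p)⁻³ T p`, replaced at a pole `w = p` by its leading coefficient `T p`,
which has the same effect on lines. -/
def gluingOp (T : (Fin 2 → ℤ) → V →L[ℂ] V) (L : ℝ) (w : ℂ) : V →L[ℂ] V :=
  if w = latticePoint L (nearestIndex L w) ∧ T (nearestIndex L w) ≠ 0 then T (nearestIndex L w)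
  else 1 + poleSum T L w

theorem gluingOp_latticePoint (hL : L ≠ 0) (hn : T n ≠ 0) :
    gluingOp T L (latticePoint L n) = T n := by
  rw [gluingOp, nearestIndex_latticePoint hL, if_pos ⟨rfl, hn⟩]

theorem gluingOp_eq_one_add_poleSum (hL : 0 < L) (hw : ‖w - latticePoint L n‖ < 7 / 8 * L)
    (hreg : T n = 0 ∨ w ≠ latticePoint L n) : gluingOp T L w = 1 + poleSum T L w := by
  refine if_neg ?_
  rintro ⟨hlattice, hpole⟩
  rcases eq_or_ne (nearestIndex L w) n with hn | hn
  · rw [hn] at hlattice hpole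
    exact hreg.elim hpole fun hne => hne hlattice
  · exact ne_latticePoint_of_ne hL hn hw hlattice

theorem span_gluingOp_apply [CompleteSpace V] (hT : ∀ m, ‖T m‖ ≤ C) (hL : 0 < L) (hn : T n ≠ 0)
    (hw : ‖w - latticePoint L n‖ < 7 / 8 * L) (x : V) :
    ℂ ∙ gluingOp T L w x = ℂ ∙ ((w - latticePoint L n) ^ 3 •
      (x + poleSum (Function.update T n 0) L w x) + T n x) := by
  rcases eq_or_ne w (latticePoint L n) with rfl | hne
  · rw [gluingOp_latticePoint hL.ne' hn, sub_self, zero_pow three_ne_zero, zero_smul, zero_add]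
  · have hcube : (w - latticePoint L n) ^ 3 ≠ 0 := pow_ne_zero 3 (sub_ne_zero.2 hne)
    rw [← Submodule.span_singleton_smul_eq hcube.isUnit, gluingOp_eq_one_add_poleSum hL hw
      (.inr hne), poleSum_eq_add_update hT hL hw]
    congr 2
    simp only [add_apply, smul_apply, one_apply_eq_self, smul_add, smul_inv_smul₀ hcube]
    abel

end GluingOperators

section GluedCurves

variable {N : ℕ} {f : ℂ → CP N} {w : ℂ} {G H : ℂ → EuclideanSpace ℂ (Fin (N + 1))}
  {T : (Fin 2 → ℤ) → EuclideanSpace ℂ (Fin (N + 1)) →L[ℂ] EuclideanSpace ℂ (Fin (N + 1))}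

open Classical in
/-- The image of the line `q` under the operator `A`; it is `q` itself if `A` vanishes on `q`. -/
def projApply (A : EuclideanSpace ℂ (Fin (N + 1)) →L[ℂ] EuclideanSpace ℂ (Fin (N + 1)))
    (q : CP N) : CP N :=
  if h : (A (unitRep q)).ofLp ≠ 0 then Projectivization.mk ℂ _ h else q

/-- The curve obtained from `f` by applying the meromorphic operator `1 + ∑ (w - p)⁻³ T p`. -/
def gluedCurve (f : ℂ → CP N)
    (T : (Fin 2 → ℤ) → EuclideanSpace ℂ (Fin (N + 1)) →L[ℂ] EuclideanSpace ℂ (Fin (N + 1)))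
    (L : ℝ) (w : ℂ) : CP N :=
  projApply (gluingOp T L w) (f w)

theorem span_apply_eq_span_unitRep_projApply
    {A : EuclideanSpace ℂ (Fin (N + 1)) →L[ℂ] EuclideanSpace ℂ (Fin (N + 1))}
    {x : EuclideanSpace ℂ (Fin (N + 1))} {q : CP N} (hx : ℂ ∙ x = ℂ ∙ unitRep q) (h0 : A x ≠ 0) :
    ℂ ∙ A x = ℂ ∙ unitRep (projApply A q) := by
  have hspan : ℂ ∙ A x = ℂ ∙ A (unitRep q) := by
    have := congrArg (Submodule.map A.toLinearMap) hx
    rwa [Submodule.map_span, Submodule.map_span, Set.image_singleton, Set.image_singleton] at this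
  have hne : (A (unitRep q)).ofLp ≠ 0 := by
    intro h
    rw [(WithLp.ofLp_eq_zero 2).1 h, Submodule.span_zero_singleton,
      Submodule.span_singleton_eq_bot] at hspan
    exact h0 hspan
  rw [hspan, span_eq_span_unitRep_iff]
  exact ⟨hne, dif_pos hne⟩

theorem isEuclideanLiftAt_gluedCurve {L : ℝ} (hG : IsEuclideanLiftAt f w G) (hH : AnalyticAt ℂ H w)
    (h0 : H w ≠ 0) (hspan : ∀ᶠ z in 𝓝 w, ℂ ∙ gluingOp T L z (G z) = ℂ ∙ H z) :
    IsEuclideanLiftAt (gluedCurve f T L) w H := by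
  refine ⟨hH, ?_⟩
  filter_upwards [hG.2, hspan, hH.continuousAt.eventually_ne h0] with z hGz hHz hne
  rw [← hHz]
  refine span_apply_eq_span_unitRep_projApply hGz fun h => hne ?_
  rwa [h, Submodule.span_zero_singleton, eq_comm, Submodule.span_singleton_eq_bot] at hHz

end GluedCurves

section Perturbation

theorem norm_deriv_le_of_forall_mem_ball_norm_sub_le {W : Type*} [NormedAddCommGroup W]
    [NormedSpace ℂ W] {φ : ℂ → W} {c : W} {w : ℂ} {C r R : ℝ} (hr : 0 < r) (hrR : r < R)
    (hd : DifferentiableOn ℂ φ (Metric.ball w R)) (hφ : ∀ z ∈ Metric.ball w R, ‖φ z - c‖ ≤ C) :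
    ‖deriv φ w‖ ≤ C / r := by
  have hsub : Metric.closedBall w r ⊆ Metric.ball w R := Metric.closedBall_subset_ball hrR
  have hdiff : DiffContOnCl ℂ (fun z => φ z - c) (Metric.ball w r) :=
    DifferentiableOn.diffContOnCl (closure_ball w hr.ne' ▸ (hd.sub_const c).mono hsub)
  simpa only [deriv_sub_const] using Complex.norm_deriv_le_of_forall_mem_sphere_norm_le hr hdiff
    fun z hz => hφ z (hsub (Metric.sphere_subset_closedBall hz))

variable {V : Type*} [NormedAddCommGroup V] [InnerProductSpace ℂ V] {B : ℂ → V →L[ℂ] V}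
  {H : ℂ → V} {w : ℂ} {β : ℝ}

theorem apply_ne_zero_of_norm_sub_one_le {A : V →L[ℂ] V} (hA : ‖A - 1‖ ≤ β) (hβ : β < 1) {x : V}
    (hx : x ≠ 0) : A x ≠ 0 :=
  norm_pos_iff.1 ((mul_pos (sub_pos.2 hβ) (norm_pos_iff.2 hx)).trans_le
    (one_sub_mul_norm_le_norm_apply hA x))

theorem abs_fsSpeed_clm_apply_sub_le (hd : DifferentiableOn ℂ B (Metric.ball w 2))
    (hB : ∀ z ∈ Metric.ball w 2, ‖B z - 1‖ ≤ β) (hβ : β ≤ 1 / 2) (hH : DifferentiableAt ℂ H w)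
    (h0 : H w ≠ 0) (hs : fsSpeed (H w) (deriv H w) ≤ 2) :
    |fsSpeed (B w (H w)) (deriv (fun z => B z (H z)) w) - fsSpeed (H w) (deriv H w)| ≤
      10 * β := by
  have hw : w ∈ Metric.ball w 2 := Metric.mem_ball_self two_pos
  have hB' : ‖deriv B w‖ ≤ β := by
    simpa only [div_one] using
      norm_deriv_le_of_forall_mem_ball_norm_sub_le one_pos one_lt_two hd hB
  have hderiv := (hd.differentiableAt (Metric.isOpen_ball.mem_nhds hw)).hasDerivAt.clm_apply
    hH.hasDerivAt
  rw [hderiv.deriv, add_comm]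
  exact abs_fsSpeed_apply_sub_le h0 (hB w hw) hB' hβ hs

end Perturbation

section ModelCurve

/-- The speed, at distance `x` from the origin, of the rational curve `t ↦ [t³ u + 8 v]` with `u`,
`v` orthonormal. -/
def cubicSpeed (x : ℝ) : ℝ := 24 * x ^ 2 / (x ^ 6 + 64)

theorem cubicSpeed_nonneg (x : ℝ) : 0 ≤ cubicSpeed x := by unfold cubicSpeed; positivity

theorem cubicSpeed_le_one (x : ℝ) : cubicSpeed x ≤ 1 := by
  have hfactor : x ^ 6 + 64 - 24 * x ^ 2 = (x ^ 2 + 6) * (x ^ 2 - 3) ^ 2 + 3 * x ^ 2 + 10 := by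
    ring
  rw [cubicSpeed, div_le_one (by positivity), ← sub_nonneg, hfactor]
  positivity

variable {V : Type*} [NormedAddCommGroup V] [InnerProductSpace ℂ V] {u v : V}

/-- The lift `t³ u + 8 v` of a rational curve of degree three. -/
def modelLift (u v : V) (t : ℂ) : V := t ^ 3 • u + (8 : ℂ) • v

theorem inner_left_modelLift (hu : ‖u‖ = 1) (huv : inner ℂ u v = 0) (t : ℂ) :
    inner ℂ u (modelLift u v t) = t ^ 3 := by
  rw [modelLift, inner_add_right, inner_smul_right, inner_smul_right, huv,
    inner_self_eq_norm_sq_to_K, hu]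
  simp

theorem norm_modelLift_sq (hu : ‖u‖ = 1) (hv : ‖v‖ = 1) (huv : inner ℂ u v = 0) (t : ℂ) :
    ‖modelLift u v t‖ ^ 2 = ‖t‖ ^ 6 + 64 := by
  have horth : inner ℂ (t ^ 3 • u) ((8 : ℂ) • v) = 0 := by
    rw [inner_smul_left, inner_smul_right, huv, mul_zero, mul_zero]
  rw [modelLift, sq, norm_add_sq_eq_norm_sq_add_norm_sq_of_inner_eq_zero _ _ horth, norm_smul,
    norm_smul, hu, hv, norm_pow, Complex.norm_ofNat]
  ring

theorem modelLift_ne_zero (hu : ‖u‖ = 1) (hv : ‖v‖ = 1) (huv : inner ℂ u v = 0) (t : ℂ) :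
    modelLift u v t ≠ 0 := by
  have hpos : 0 < ‖modelLift u v t‖ ^ 2 := by rw [norm_modelLift_sq hu hv huv]; positivity
  rintro h
  simp [h] at hpos

theorem hasDerivAt_modelLift_sub (u v : V) (p z : ℂ) :
    HasDerivAt (fun z => modelLift u v (z - p)) ((3 * (z - p) ^ 2) • u) z := by
  have hcube : HasDerivAt (fun z : ℂ => (z - p) ^ 3) (3 * (z - p) ^ 2) z := by
    simpa using ((hasDerivAt_id z).sub_const p).fun_pow 3
  exact (hcube.smul_const u).add_const _

theorem fsSpeed_modelLift (hu : ‖u‖ = 1) (hv : ‖v‖ = 1) (huv : inner ℂ u v = 0) (t : ℂ) :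
    fsSpeed (modelLift u v t) ((3 * t ^ 2) • u) = cubicSpeed ‖t‖ := by
  have hinner : ‖inner ℂ (modelLift u v t) ((3 * t ^ 2) • u)‖ = 3 * ‖t‖ ^ 5 := by
    rw [norm_inner_symm, inner_smul_left, inner_left_modelLift hu huv, norm_mul,
      RCLike.norm_conj, norm_mul, norm_pow, norm_pow, Complex.norm_ofNat]
    ring
  have hsq := fsSpeed_sq (modelLift_ne_zero hu hv huv t) ((3 * t ^ 2) • u)
  have hfour : ‖modelLift u v t‖ ^ 4 = (‖t‖ ^ 6 + 64) ^ 2 := by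
    rw [← norm_modelLift_sq hu hv huv]
    ring
  rw [hinner, hfour, norm_modelLift_sq hu hv huv, norm_smul, hu, norm_mul, norm_pow,
    Complex.norm_ofNat] at hsq
  rw [← sq_eq_sq₀ (fsSpeed_nonneg _ _) (cubicSpeed_nonneg _), hsq, cubicSpeed]
  field_simp
  ring

theorem one_add_smulRight_modelLift (hu : ‖u‖ = 1) (huv : inner ℂ u v = 0) (x : V) (t : ℂ) :
    (1 + (innerSL ℂ u).smulRight x) (modelLift u v t) = t ^ 3 • (u + x) + (8 : ℂ) • v := by
  rw [add_apply, one_apply_eq_self, ContinuousLinearMap.smulRight_apply, innerSL_apply_apply,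
    inner_left_modelLift hu huv, modelLift]
  module

variable {s : ℂ → V} {p w : ℂ} {σ : ℝ}

theorem differentiableOn_one_add_smulRight {U : Set ℂ} (u : V) (hs : DifferentiableOn ℂ s U) :
    DifferentiableOn ℂ (fun z => 1 + (innerSL ℂ u).smulRight (s z)) U :=
  ((ContinuousLinearMap.smulRightL ℂ V V
    (innerSL ℂ u)).differentiable.comp_differentiableOn hs).const_add 1

theorem norm_one_add_smulRight_sub_one (hu : ‖u‖ = 1) (x : V) :
    ‖1 + (innerSL ℂ u).smulRight x - 1‖ = ‖x‖ := by
  rw [add_sub_cancel_left, ContinuousLinearMap.norm_smulRight_apply, innerSL_apply_norm, hu,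
    one_mul]

theorem perturbedCubic_ne_zero (hu : ‖u‖ = 1) (hv : ‖v‖ = 1) (huv : inner ℂ u v = 0) {x : V}
    (hx : ‖x‖ < 1) (t : ℂ) : t ^ 3 • (u + x) + (8 : ℂ) • v ≠ 0 := by
  rw [← one_add_smulRight_modelLift hu huv]
  exact apply_ne_zero_of_norm_sub_one_le (norm_one_add_smulRight_sub_one hu x).le hx
    (modelLift_ne_zero hu hv huv t)

theorem abs_fsSpeed_perturbedCubic_sub_le (hu : ‖u‖ = 1) (hv : ‖v‖ = 1) (huv : inner ℂ u v = 0)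
    (hs : DifferentiableOn ℂ s (Metric.ball w 2)) (hsσ : ∀ z ∈ Metric.ball w 2, ‖s z‖ ≤ σ)
    (hσ : σ ≤ 1 / 2) :
    |fsSpeed ((w - p) ^ 3 • (u + s w) + (8 : ℂ) • v)
        (deriv (fun z => (z - p) ^ 3 • (u + s z) + (8 : ℂ) • v) w) -
      cubicSpeed ‖w - p‖| ≤ 10 * σ := by
  have hspeed : fsSpeed (modelLift u v (w - p)) (deriv (fun z => modelLift u v (z - p)) w) =
      cubicSpeed ‖w - p‖ := by
    rw [(hasDerivAt_modelLift_sub u v p w).deriv, fsSpeed_modelLift hu hv huv]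
  have hperturb := abs_fsSpeed_clm_apply_sub_le (H := fun z => modelLift u v (z - p))
    (differentiableOn_one_add_smulRight u hs)
    (fun z hz => (norm_one_add_smulRight_sub_one hu (s z)).trans_le (hsσ z hz)) hσ
    (hasDerivAt_modelLift_sub u v p w).differentiableAt (modelLift_ne_zero hu hv huv _)
    (hspeed.trans_le ((cubicSpeed_le_one _).trans one_le_two))
  rw [hspeed] at hperturb
  simpa only [one_add_smulRight_modelLift hu huv] using hperturb

end ModelCurve

section NormalizedLifts

theorem one_le_sqrt_pi : 1 ≤ √Real.pi := by
  rw [Real.one_le_sqrt]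
  linarith [Real.pi_gt_three]

theorem sqrt_pi_le_two : √Real.pi ≤ 2 := by
  rw [Real.sqrt_le_left two_pos.le]
  linarith [Real.pi_le_four]

variable {N : ℕ} {f : ℂ → CP N} {p z : ℂ} {η ρ : ℝ} {u : EuclideanSpace ℂ (Fin (N + 1))}
  {G : ℂ → EuclideanSpace ℂ (Fin (N + 1))}

theorem norm_inner_unitRep_sq {x : EuclideanSpace ℂ (Fin (N + 1))} {q : CP N}
    (hx : ℂ ∙ x = ℂ ∙ unitRep q) (u : EuclideanSpace ℂ (Fin (N + 1))) :
    ‖(inner ℂ u (unitRep q) : ℂ)‖ ^ 2 = ‖(inner ℂ u x : ℂ)‖ ^ 2 / ‖x‖ ^ 2 := by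
  obtain ⟨a, ha⟩ := Submodule.span_singleton_eq_span_singleton.1 hx
  have hax : ‖(a : ℂ)‖ * ‖x‖ = 1 := by rw [← norm_smul, ← norm_unitRep q, ← ha]; rfl
  have hx0 : ‖x‖ ≠ 0 := right_ne_zero_of_mul_eq_one hax
  rw [← ha, Units.smul_def, inner_smul_right, norm_mul, eq_div_of_mul_eq hx0 hax]
  field_simp

theorem IsEuclideanLiftAt.eventuallyEq_norm_inner_unitRep_sq (hG : IsEuclideanLiftAt f z G)
    (u : EuclideanSpace ℂ (Fin (N + 1))) :
    (fun w => ‖(inner ℂ u (unitRep (f w)) : ℂ)‖ ^ 2) =ᶠ[𝓝 z]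
      fun w => ‖(inner ℂ u (G w) : ℂ)‖ ^ 2 / ‖G w‖ ^ 2 :=
  hG.2.mono fun _ hw => norm_inner_unitRep_sq hw u

theorem IsHolomorphicCurve.differentiableAt_norm_inner_unitRep_sq (hf : IsHolomorphicCurve f)
    (u : EuclideanSpace ℂ (Fin (N + 1))) (z : ℂ) :
    DifferentiableAt ℝ (fun w => ‖(inner ℂ u (unitRep (f w)) : ℂ)‖ ^ 2) z := by
  obtain ⟨G, hG⟩ := isHolomorphicCurve_iff_exists_lift.1 hf z
  exact (differentiableAt_cos_sq u hG.1 hG.ne_zero).congr_of_eventuallyEq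
    (hG.eventuallyEq_norm_inner_unitRep_sq u)

theorem IsHolomorphicCurve.norm_fderiv_norm_inner_unitRep_sq_le (hf : IsHolomorphicCurve f)
    (hu : ‖u‖ ≤ 1) (z : ℂ) :
    ‖fderiv ℝ (fun w => ‖(inner ℂ u (unitRep (f w)) : ℂ)‖ ^ 2) z‖ ≤ 4 * localLip f z := by
  obtain ⟨G, hG⟩ := isHolomorphicCurve_iff_exists_lift.1 hf z
  rw [(hG.eventuallyEq_norm_inner_unitRep_sq u).fderiv_eq]
  refine (norm_fderiv_cos_sq_le hu hG.1 hG.ne_zero).trans ?_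
  rw [hG.fsSpeed_eq]
  nlinarith [sqrt_pi_le_two, localLip_nonneg f z]

theorem IsHolomorphicCurve.one_sub_le_norm_inner_unitRep_sq (hf : IsHolomorphicCurve f)
    (hη : ∀ z ∈ Metric.ball p ρ, localLip f z ≤ η) (hz : z ∈ Metric.ball p ρ) :
    1 - 4 * η * ρ ≤ ‖(inner ℂ (unitRep (f p)) (unitRep (f z)) : ℂ)‖ ^ 2 := by
  have hp : p ∈ Metric.ball p ρ := Metric.mem_ball_self (dist_nonneg.trans_lt hz)
  have hη0 : 0 ≤ η := (localLip_nonneg f p).trans (hη p hp)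
  have hmean := (convex_ball p ρ).norm_image_sub_le_of_norm_fderiv_le (C := 4 * η)
    (fun w _ => hf.differentiableAt_norm_inner_unitRep_sq (unitRep (f p)) w)
    (fun w hw => (hf.norm_fderiv_norm_inner_unitRep_sq_le (norm_unitRep (f p)).le w).trans
      (by linarith [hη w hw])) hp hz
  rw [inner_self_eq_norm_sq_to_K, norm_unitRep, RCLike.ofReal_one, one_pow, norm_one, one_pow]
    at hmean
  rw [mem_ball_iff_norm] at hz
  nlinarith [(abs_le.1 hmean).1]

/-- The lift of `f` whose inner product with `u` is `1`, where such a lift exists. -/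
def normalizedLift (f : ℂ → CP N) (u : EuclideanSpace ℂ (Fin (N + 1))) (w : ℂ) :
    EuclideanSpace ℂ (Fin (N + 1)) :=
  (inner ℂ u (unitRep (f w)))⁻¹ • unitRep (f w)

theorem inner_normalizedLift (h0 : (inner ℂ u (unitRep (f z)) : ℂ) ≠ 0) :
    inner ℂ u (normalizedLift f u z) = 1 := by
  rw [normalizedLift, inner_smul_right, inv_mul_cancel₀ h0]

theorem inv_inner_smul_eq_normalizedLift {x : EuclideanSpace ℂ (Fin (N + 1))}
    (hx : ℂ ∙ x = ℂ ∙ unitRep (f z)) :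
    (inner ℂ u x : ℂ)⁻¹ • x = normalizedLift f u z := by
  obtain ⟨a, ha⟩ := Submodule.span_singleton_eq_span_singleton.1 hx
  rw [normalizedLift, ← ha, Units.smul_def, inner_smul_right, smul_smul, mul_inv, mul_right_comm,
    inv_mul_cancel₀ a.ne_zero, one_mul]

theorem IsHolomorphicCurve.isEuclideanLiftAt_normalizedLift (hf : IsHolomorphicCurve f)
    (h0 : (inner ℂ u (unitRep (f z)) : ℂ) ≠ 0) :
    IsEuclideanLiftAt f z (normalizedLift f u) := by
  obtain ⟨G, hG⟩ := isHolomorphicCurve_iff_exists_lift.1 hf z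
  have hinner := analyticAt_inner_left u hG.1
  have hG0 : inner ℂ u (G z) ≠ 0 := by
    obtain ⟨a, ha⟩ := Submodule.span_singleton_eq_span_singleton.1 hG.2.self_of_nhds
    rw [← ha, Units.smul_def, inner_smul_right] at h0
    exact right_ne_zero_of_mul h0
  refine ⟨((hinner.inv hG0).smul hG.1).congr
    (hG.2.mono fun w hw => inv_inner_smul_eq_normalizedLift hw), ?_⟩
  filter_upwards [hG.2, hinner.continuousAt.eventually_ne hG0] with w hw hw0
  rw [← inv_inner_smul_eq_normalizedLift hw, ← hw,
    Submodule.span_singleton_smul_eq (inv_ne_zero hw0).isUnit]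

theorem norm_normalizedLift_sub_sq (hu : ‖u‖ = 1) (h0 : (inner ℂ u (unitRep (f z)) : ℂ) ≠ 0) :
    ‖normalizedLift f u z - u‖ ^ 2 = (‖(inner ℂ u (unitRep (f z)) : ℂ)‖ ^ 2)⁻¹ - 1 := by
  have hnorm : ‖normalizedLift f u z‖ = ‖(inner ℂ u (unitRep (f z)) : ℂ)‖⁻¹ := by
    rw [normalizedLift, norm_smul, norm_inv, norm_unitRep, mul_one]
  rw [norm_sub_sq (𝕜 := ℂ), ← inner_conj_symm, inner_normalizedLift h0, hu, hnorm, map_one,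
    RCLike.one_re, inv_pow]
  ring

theorem IsHolomorphicCurve.inner_unitRep_ne_zero (hf : IsHolomorphicCurve f)
    (hη : ∀ z ∈ Metric.ball p ρ, localLip f z ≤ η) (hηρ : 4 * η * ρ < 1)
    (hz : z ∈ Metric.ball p ρ) : (inner ℂ (unitRep (f p)) (unitRep (f z)) : ℂ) ≠ 0 := by
  intro h
  have hcos := hf.one_sub_le_norm_inner_unitRep_sq hη hz
  rw [h, norm_zero, zero_pow two_ne_zero] at hcos
  linarith

theorem IsHolomorphicCurve.norm_normalizedLift_sub_sq_le (hf : IsHolomorphicCurve f)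
    (hη : ∀ z ∈ Metric.ball p ρ, localLip f z ≤ η) (hηρ : 8 * η * ρ ≤ 1)
    (hz : z ∈ Metric.ball p ρ) :
    ‖normalizedLift f (unitRep (f p)) z - unitRep (f p)‖ ^ 2 ≤ 8 * η * ρ := by
  have hcos := hf.one_sub_le_norm_inner_unitRep_sq hη hz
  have hη0 : 0 ≤ η * ρ :=
    mul_nonneg ((localLip_nonneg f z).trans (hη z hz)) (dist_nonneg.trans hz.le)
  have h0 := hf.inner_unitRep_ne_zero hη (by linarith) hz
  rw [norm_normalizedLift_sub_sq (norm_unitRep _) h0, sub_le_iff_le_add',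
    inv_le_iff_one_le_mul₀ (by linarith)]
  have hprod : 1 ≤ (1 + 8 * η * ρ) * (1 - 4 * η * ρ) := by nlinarith
  exact hprod.trans (mul_le_mul_of_nonneg_left hcos (by linarith))

end NormalizedLifts

theorem exists_norm_eq_one_inner_eq_zero {𝕜 V : Type*} [RCLike 𝕜] [NormedAddCommGroup V]
    [InnerProductSpace 𝕜 V] (hV : 1 < Module.finrank 𝕜 V) (u : V) :
    ∃ v : V, ‖v‖ = 1 ∧ inner 𝕜 u v = 0 := by
  have hne : (𝕜 ∙ u)ᗮ ≠ ⊥ := by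
    rw [Ne, Submodule.orthogonal_eq_bot_iff]
    exact fun htop => hV.not_ge
      (finrank_le_one u fun w => Submodule.mem_span_singleton.1 (htop ▸ Submodule.mem_top))
  have := (Submodule.nontrivial_iff_ne_bot).2 hne
  let := NormedSpace.restrictScalars ℝ 𝕜 (𝕜 ∙ u)ᗮ
  obtain ⟨v, hv⟩ := exists_norm_eq (𝕜 ∙ u)ᗮ zero_le_one
  exact ⟨v, hv, Submodule.mem_orthogonal_singleton_iff_inner_right.1 v.2⟩

section SpeedOfGluedCurve

variable {N : ℕ} {f : ℂ → CP N} {L C β : ℝ} {n : Fin 2 → ℤ} {w z : ℂ}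
  {T : (Fin 2 → ℤ) → EuclideanSpace ℂ (Fin (N + 1)) →L[ℂ] EuclideanSpace ℂ (Fin (N + 1))}
  {G : ℂ → EuclideanSpace ℂ (Fin (N + 1))}

theorem IsEuclideanLiftAt.gluedCurve_of_regular (hG : IsEuclideanLiftAt f w G)
    (hT : ∀ m, ‖T m‖ ≤ C) (hL : 0 < L) (hw : ‖w - latticePoint L n‖ < 7 / 8 * L)
    (hreg : T n = 0 ∨ w ≠ latticePoint L n) (hlt : ‖poleSum T L w‖ < 1) :
    IsEuclideanLiftAt (gluedCurve f T L) w fun z => (1 + poleSum T L z) (G z) := by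
  have hop : AnalyticAt ℂ (fun z => 1 + poleSum T L z) w :=
    analyticAt_const.fun_add (analyticAt_poleSum hT hL hw hreg)
  refine isEuclideanLiftAt_gluedCurve hG
    (((ContinuousLinearMap.id ℂ _).analyticAt_bilinear _).comp₂ hop hG.1)
    (apply_ne_zero_of_norm_sub_one_le (by rw [add_sub_cancel_left]) hlt hG.ne_zero) ?_
  have hreg_near : ∀ᶠ z in 𝓝 w, T n = 0 ∨ z ≠ latticePoint L n :=
    hreg.elim (fun h => Eventually.of_forall fun _ => .inl h)
      fun h => (eventually_ne_nhds h).mono fun _ => .inr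
  filter_upwards [hreg_near, Metric.isOpen_ball.mem_nhds (mem_ball_iff_norm.2 hw)] with z hz hzL
  rw [gluingOp_eq_one_add_poleSum hL (mem_ball_iff_norm.1 hzL) hz]

theorem norm_sub_latticePoint_lt_of_mem_ball (hL : 16 ≤ L)
    (hw : ‖w - latticePoint L n‖ ≤ 3 / 4 * L) (hz : z ∈ Metric.ball w 2) :
    ‖z - latticePoint L n‖ < 7 / 8 * L := by
  rw [mem_ball_iff_norm] at hz
  linarith [norm_sub_le_norm_sub_add_norm_sub z w (latticePoint L n)]

theorem IsHolomorphicCurve.abs_localLip_gluedCurve_sub_le (hf : IsHolomorphicCurve f)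
    (hf1 : localLip f w ≤ 1) (hT : ∀ m, ‖T m‖ ≤ C) (hL : 16 ≤ L)
    (hw : ‖w - latticePoint L n‖ ≤ 3 / 4 * L)
    (hreg : ∀ z ∈ Metric.ball w 2, T n = 0 ∨ z ≠ latticePoint L n)
    (hB : ∀ z ∈ Metric.ball w 2, ‖poleSum T L z‖ ≤ β) (hβ : β ≤ 1 / 2) :
    (∃ H, IsEuclideanLiftAt (gluedCurve f T L) w H) ∧
      |localLip (gluedCurve f T L) w - localLip f w| ≤ 10 * β := by
  have hL0 : 0 < L := by linarith
  have hwL := fun z (hz : z ∈ Metric.ball w 2) => norm_sub_latticePoint_lt_of_mem_ball hL hw hz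
  have hww : w ∈ Metric.ball w 2 := Metric.mem_ball_self two_pos
  obtain ⟨G, hG⟩ := isHolomorphicCurve_iff_exists_lift.1 hf w
  have hlift := hG.gluedCurve_of_regular hT hL0 (hwL w hww) (hreg w hww)
    ((hB w hww).trans_lt (by linarith))
  refine ⟨⟨_, hlift⟩, ?_⟩
  have hd : DifferentiableOn ℂ (fun z => 1 + poleSum T L z) (Metric.ball w 2) := fun z hz =>
    ((analyticAt_poleSum hT hL0 (hwL z hz)
      (hreg z hz)).differentiableAt.const_add 1).differentiableWithinAt
  have hspeed := abs_fsSpeed_clm_apply_sub_le hd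
    (fun z hz => by rw [add_sub_cancel_left]; exact hB z hz) hβ hG.1.differentiableAt hG.ne_zero
    (by rw [hG.fsSpeed_eq]
        exact (mul_le_of_le_one_right (Real.sqrt_nonneg _) hf1).trans sqrt_pi_le_two)
  rw [hlift.fsSpeed_eq, hG.fsSpeed_eq, ← mul_sub, abs_mul, abs_of_nonneg (Real.sqrt_nonneg _)]
    at hspeed
  exact (le_mul_of_one_le_left (abs_nonneg _) one_le_sqrt_pi).trans hspeed

/-- The deviation from `u = unitRep (f p)` of the lift of the glued curve near the pole
`p = latticePoint L n`, once the pole has been cleared; see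
`IsHolomorphicCurve.isEuclideanLiftAt_gluedCurve_pole`. -/
def gluingError (f : ℂ → CP N)
    (T : (Fin 2 → ℤ) → EuclideanSpace ℂ (Fin (N + 1)) →L[ℂ] EuclideanSpace ℂ (Fin (N + 1)))
    (L : ℝ) (n : Fin 2 → ℤ) (z : ℂ) : EuclideanSpace ℂ (Fin (N + 1)) :=
  normalizedLift f (unitRep (f (latticePoint L n))) z - unitRep (f (latticePoint L n)) +
    poleSum (Function.update T n 0) L z (normalizedLift f (unitRep (f (latticePoint L n))) z)

variable {v : EuclideanSpace ℂ (Fin (N + 1))} {η ρ μ : ℝ}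

theorem IsHolomorphicCurve.differentiableAt_gluingError (hf : IsHolomorphicCurve f)
    (h0 : (inner ℂ (unitRep (f (latticePoint L n))) (unitRep (f z)) : ℂ) ≠ 0)
    (hT : ∀ m, ‖T m‖ ≤ C) (hL : 0 < L) (hz : ‖z - latticePoint L n‖ < 7 / 8 * L) :
    DifferentiableAt ℂ (gluingError f T L n) z := by
  have hlift := (hf.isEuclideanLiftAt_normalizedLift h0).1.differentiableAt
  have hregular := (analyticAt_poleSum (norm_update_zero_le hT n) hL hz
    (.inl (Function.update_self n 0 T))).differentiableAt
  exact (hlift.sub_const _).add (hregular.clm_apply hlift)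

theorem IsHolomorphicCurve.norm_gluingError_le (hf : IsHolomorphicCurve f)
    (hη : ∀ z ∈ Metric.ball (latticePoint L n) ρ, localLip f z ≤ η) (hμ0 : 0 ≤ μ) (hμ1 : μ ≤ 1)
    (hμ : 8 * η * ρ ≤ μ ^ 2) (hT : ∀ m, ‖T m‖ ≤ C) (hL : 0 < L)
    (hz : z ∈ Metric.ball (latticePoint L n) ρ) (hzL : ‖z - latticePoint L n‖ < 7 / 8 * L) :
    ‖gluingError f T L n z‖ ≤ μ + 2 * (C * (8 / L) ^ 3 * cubeLatticeSum) := by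
  have hregular := norm_poleSum_le (norm_update_zero_le hT n) (Function.update_self n 0 T) hL hzL
  have hsub := le_of_sq_le_sq
    ((hf.norm_normalizedLift_sub_sq_le hη (hμ.trans (pow_le_one₀ hμ0 hμ1)) hz).trans hμ) hμ0
  have hlift : ‖normalizedLift f (unitRep (f (latticePoint L n))) z‖ ≤ 2 := by
    linarith [norm_sub_norm_le (normalizedLift f (unitRep (f (latticePoint L n))) z)
      (unitRep (f (latticePoint L n))), norm_unitRep (f (latticePoint L n))]
  rw [mul_comm 2]
  exact norm_add_le_of_le hsub (ContinuousLinearMap.le_of_opNorm_le_of_le _ hregular hlift)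

theorem IsHolomorphicCurve.isEuclideanLiftAt_gluedCurve_pole (hf : IsHolomorphicCurve f)
    (hT : ∀ m, ‖T m‖ ≤ C) (hL : 0 < L) (hv : v ≠ 0)
    (hTn : T n = (8 : ℂ) • (innerSL ℂ (unitRep (f (latticePoint L n)))).smulRight v)
    (h0 : ∀ᶠ z in 𝓝 w, (inner ℂ (unitRep (f (latticePoint L n))) (unitRep (f z)) : ℂ) ≠ 0)
    (hw : ‖w - latticePoint L n‖ < 7 / 8 * L)
    (hne : (w - latticePoint L n) ^ 3 • (unitRep (f (latticePoint L n)) + gluingError f T L n w) +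
      (8 : ℂ) • v ≠ 0) :
    IsEuclideanLiftAt (gluedCurve f T L) w fun z => (z - latticePoint L n) ^ 3 •
      (unitRep (f (latticePoint L n)) + gluingError f T L n z) + (8 : ℂ) • v := by
  have hT0 : T n ≠ 0 := by
    rw [← norm_pos_iff, hTn, norm_smul, ContinuousLinearMap.norm_smulRight_apply,
      innerSL_apply_norm, norm_unitRep, Complex.norm_ofNat]
    positivity
  have hnear := h0.and (Metric.isOpen_ball.mem_nhds (mem_ball_iff_norm.2 hw))
  have han : AnalyticAt ℂ (gluingError f T L n) w :=
    Complex.analyticAt_iff_eventually_differentiableAt.2 (hnear.mono fun z hz =>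
      hf.differentiableAt_gluingError hz.1 hT hL (mem_ball_iff_norm.1 hz.2))
  have hcube : AnalyticAt ℂ (fun z : ℂ => (z - latticePoint L n) ^ 3) w := by fun_prop
  refine isEuclideanLiftAt_gluedCurve (hf.isEuclideanLiftAt_normalizedLift h0.self_of_nhds)
    ((hcube.fun_smul (analyticAt_const.fun_add han)).fun_add analyticAt_const) hne ?_
  filter_upwards [hnear] with z hz
  rw [span_gluingOp_apply hT hL hT0 (mem_ball_iff_norm.1 hz.2), hTn, smul_apply,
    ContinuousLinearMap.smulRight_apply, innerSL_apply_apply, inner_normalizedLift hz.1, one_smul,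
    gluingError, ← add_assoc, add_sub_cancel]

theorem IsHolomorphicCurve.abs_localLip_gluedCurve_sub_cubicSpeed_le (hf : IsHolomorphicCurve f)
    (hη : ∀ z ∈ Metric.ball (latticePoint L n) ρ, localLip f z ≤ η) (hμ0 : 0 ≤ μ) (hμ1 : μ ≤ 1)
    (hμ : 8 * η * ρ ≤ μ ^ 2) (hT : ∀ m, ‖T m‖ ≤ C) (hL : 0 < L) (hv : ‖v‖ = 1)
    (huv : inner ℂ (unitRep (f (latticePoint L n))) v = 0)
    (hTn : T n = (8 : ℂ) • (innerSL ℂ (unitRep (f (latticePoint L n)))).smulRight v)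
    (hρ : ρ ≤ 7 / 8 * L) (hw : ‖w - latticePoint L n‖ ≤ ρ - 2)
    (hσ : μ + 2 * (C * (8 / L) ^ 3 * cubeLatticeSum) ≤ 1 / 2) :
    (∃ H, IsEuclideanLiftAt (gluedCurve f T L) w H) ∧
      |√Real.pi * localLip (gluedCurve f T L) w - cubicSpeed ‖w - latticePoint L n‖| ≤
        10 * (μ + 2 * (C * (8 / L) ^ 3 * cubeLatticeSum)) := by
  have hww : w ∈ Metric.ball w 2 := Metric.mem_ball_self two_pos
  have hsub : Metric.ball w 2 ⊆ Metric.ball (latticePoint L n) ρ := by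
    refine Metric.ball_subset_ball' ?_
    rw [dist_eq_norm]
    linarith
  have hlt : ∀ z ∈ Metric.ball w 2, ‖z - latticePoint L n‖ < 7 / 8 * L := fun z hz =>
    (mem_ball_iff_norm.1 (hsub hz)).trans_le hρ
  have h0 : ∀ z ∈ Metric.ball w 2,
      (inner ℂ (unitRep (f (latticePoint L n))) (unitRep (f z)) : ℂ) ≠ 0 := fun z hz =>
    hf.inner_unitRep_ne_zero hη (by nlinarith) (hsub hz)
  have herror : ∀ z ∈ Metric.ball w 2, ‖gluingError f T L n z‖ ≤ _ := fun z hz =>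
    hf.norm_gluingError_le hη hμ0 hμ1 hμ hT hL (hsub hz) (hlt z hz)
  have hlift := hf.isEuclideanLiftAt_gluedCurve_pole hT hL (norm_ne_zero_iff.1 (by simp [hv])) hTn
    (eventually_of_mem (Metric.isOpen_ball.mem_nhds hww) h0) (hlt w hww)
    (perturbedCubic_ne_zero (norm_unitRep _) hv huv ((herror w hww).trans_lt (by linarith)) _)
  refine ⟨⟨_, hlift⟩, ?_⟩
  rw [← hlift.fsSpeed_eq]
  exact abs_fsSpeed_perturbedCubic_sub_le (norm_unitRep _) hv huv (fun z hz =>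
    (hf.differentiableAt_gluingError (h0 z hz) hT hL (hlt z hz)).differentiableWithinAt) herror hσ

end SpeedOfGluedCurve

section GluingScales

variable {N : ℕ} {f : ℂ → CP N} {δ r η L : ℝ} {n : Fin 2 → ℤ} {w : ℂ}
  {T : (Fin 2 → ℤ) → EuclideanSpace ℂ (Fin (N + 1)) →L[ℂ] EuclideanSpace ℂ (Fin (N + 1))}

/-- The scales of a gluing which changes the local Lipschitz constant by at most `δ`, except near
points where it increases it: a curve is modified at those points of the square lattice of side `L`
around which its local Lipschitz constant is at most `η` up to distance `r + 2`. -/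
structure IsGluingScale (δ r η L : ℝ) : Prop where
  eta_pos : 0 < η
  eta_le : η ≤ δ
  two_lt : 2 < r
  eta_mul_le : 8 * η * (r + 2) ≤ (1 / 25) ^ 2
  sixteen_le : 16 ≤ L
  radius_le : r + 2 ≤ 3 / 4 * L
  pole_le : 8 / (r - 2) ^ 3 ≤ δ / 20
  tail_le : 8 * (8 / L) ^ 3 * cubeLatticeSum ≤ η / 20

theorem exists_isGluingScale (hδ : 0 < δ) (hδ1 : δ ≤ 1) : ∃ r η L, IsGluingScale δ r η L := by
  have hrδ : 160 / δ * δ = 160 := div_mul_cancel₀ _ hδ.ne'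
  have hr : 160 ≤ 160 / δ := by rw [le_div_iff₀ hδ]; linarith
  set r := 2 + 160 / δ with hrdef
  set η := 1 / (5000 * (r + 2)) with hηdef
  have hr2 : 0 < r + 2 := by positivity
  have hη : 0 < η := by positivity
  have hηr : η * (r + 2) = 1 / 5000 := by rw [hηdef]; field_simp
  have hS : 0 ≤ 81920 * cubeLatticeSum / η := by have := cubeLatticeSum_nonneg; positivity
  set L := 16 + 2 * (r + 2) + 81920 * cubeLatticeSum / η with hLdef
  have hL : 16 ≤ L := by linarith only [hLdef, hS, hr2]
  refine ⟨r, η, L, hη, by nlinarith, by linarith, by linarith, hL, by linarith, ?_, ?_⟩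
  · rw [hrdef, add_sub_cancel_left, div_le_div_iff₀ (by positivity) (by norm_num), pow_succ,
      mul_left_comm, mul_comm δ, hrδ]
    nlinarith
  · have htail : 81920 * cubeLatticeSum ≤ L * η := by rw [← div_le_iff₀ hη]; linarith
    have hcube : L ≤ L ^ 3 := le_self_pow₀ (by linarith) three_ne_zero
    rw [div_pow, ← mul_div_assoc, div_mul_eq_mul_div, div_le_div_iff₀ (by positivity) (by norm_num)]
    nlinarith

/-- The local Lipschitz constant of `f` is at most `η` around the lattice point of index `n`. -/
def IsSlowAt (f : ℂ → CP N) (r η L : ℝ) (n : Fin 2 → ℤ) : Prop :=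
  ∀ z ∈ Metric.ball (latticePoint L n) (r + 2), localLip f z ≤ η

/-- The coefficients `T` glue the rational curve `t ↦ [t³ u + 8 v]` into `f` at each lattice point
around which `f` is slow. Here `u` spans the line `f p`, while `v` is a unit vector orthogonal
to it. -/
structure IsGluing (f : ℂ → CP N) (r η L : ℝ)
    (T : (Fin 2 → ℤ) → EuclideanSpace ℂ (Fin (N + 1)) →L[ℂ] EuclideanSpace ℂ (Fin (N + 1))) :
    Prop where
  eq_zero : ∀ n, ¬IsSlowAt f r η L n → T n = 0
  eq_smulRight : ∀ n, IsSlowAt f r η L n → ∃ v, ‖v‖ = 1 ∧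
    inner ℂ (unitRep (f (latticePoint L n))) v = 0 ∧
      T n = (8 : ℂ) • (innerSL ℂ (unitRep (f (latticePoint L n)))).smulRight v

open Classical in
theorem exists_isGluing (hN : 1 ≤ N) (f : ℂ → CP N) (r η L : ℝ) : ∃ T, IsGluing f r η L T := by
  have hdim : 1 < Module.finrank ℂ (EuclideanSpace ℂ (Fin (N + 1))) := by
    rw [finrank_euclideanSpace_fin]
    omega
  choose v hv huv using fun n =>
    exists_norm_eq_one_inner_eq_zero hdim (unitRep (f (latticePoint L n)))
  exact ⟨fun n => if IsSlowAt f r η L n then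
    (8 : ℂ) • (innerSL ℂ (unitRep (f (latticePoint L n)))).smulRight (v n) else 0,
    fun _ hn => if_neg hn, fun n hn => ⟨v n, hv n, huv n, if_pos hn⟩⟩

theorem IsGluing.norm_le (hT : IsGluing f r η L T) (n : Fin 2 → ℤ) : ‖T n‖ ≤ 8 := by
  by_cases hn : IsSlowAt f r η L n
  · obtain ⟨v, hv, -, hTn⟩ := hT.eq_smulRight n hn
    rw [hTn, norm_smul, ContinuousLinearMap.norm_smulRight_apply, innerSL_apply_norm,
      norm_unitRep, hv]
    norm_num
  · rw [hT.eq_zero n hn, norm_zero]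
    norm_num

theorem IsGluing.abs_localLip_sub_le_of_not_isSlowAt (hT : IsGluing f r η L T)
    (hs : IsGluingScale δ r η L) (hf : IsHolomorphicCurve f) (hf1 : localLip f w ≤ 1)
    (hn : ¬IsSlowAt f r η L n) (hw : ‖w - latticePoint L n‖ ≤ 3 / 4 * L) :
    (∃ H, IsEuclideanLiftAt (gluedCurve f T L) w H) ∧
      |localLip (gluedCurve f T L) w - localLip f w| ≤ η / 2 := by
  have hη : η ≤ 1 := by nlinarith [hs.eta_mul_le, hs.two_lt, hs.eta_pos]
  have hL : 0 < L := by linarith [hs.sixteen_le]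
  have hTn := hT.eq_zero n hn
  refine (hf.abs_localLip_gluedCurve_sub_le (β := η / 20) hf1 hT.norm_le hs.sixteen_le hw
    (fun _ _ => .inl hTn) (fun z hz => ?_) (by linarith)).imp_right fun h => h.trans (by linarith)
  exact (norm_poleSum_le hT.norm_le hTn hL
    (norm_sub_latticePoint_lt_of_mem_ball hs.sixteen_le hw hz)).trans hs.tail_le

theorem IsGluing.abs_localLip_sub_le_of_le_norm_sub (hT : IsGluing f r η L T)
    (hs : IsGluingScale δ r η L) (hδ1 : δ ≤ 1) (hf : IsHolomorphicCurve f) (hf1 : localLip f w ≤ 1)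
    (hrw : r ≤ ‖w - latticePoint L n‖) (hw : ‖w - latticePoint L n‖ ≤ 3 / 4 * L) :
    (∃ H, IsEuclideanLiftAt (gluedCurve f T L) w H) ∧
      |localLip (gluedCurve f T L) w - localLip f w| ≤ δ := by
  have hL : 0 < L := by linarith [hs.sixteen_le]
  have hr : 0 < r - 2 := by linarith [hs.two_lt]
  have hfar : ∀ z ∈ Metric.ball w 2, r - 2 ≤ ‖z - latticePoint L n‖ := fun z hz => by
    rw [mem_ball_iff_norm'] at hz
    linarith [norm_sub_le_norm_sub_add_norm_sub w z (latticePoint L n)]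
  refine (hf.abs_localLip_gluedCurve_sub_le (β := δ / 10) hf1 hT.norm_le hs.sixteen_le hw
    (fun z hz => .inr (sub_ne_zero.1 (norm_pos_iff.1 (hr.trans_le (hfar z hz)))))
    (fun z hz => ?_) (by linarith)).imp_right fun h => h.trans (by linarith)
  refine (norm_poleSum_le_of_le_norm_sub hT.norm_le hL hr (hfar z hz)
    (norm_sub_latticePoint_lt_of_mem_ball hs.sixteen_le hw hz)).trans ?_
  linarith [hs.pole_le, hs.tail_le, hs.eta_le]

theorem IsGluing.abs_localLip_sub_cubicSpeed_le (hT : IsGluing f r η L T)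
    (hs : IsGluingScale δ r η L) (hf : IsHolomorphicCurve f) (hn : IsSlowAt f r η L n)
    (hw : ‖w - latticePoint L n‖ ≤ r) :
    (∃ H, IsEuclideanLiftAt (gluedCurve f T L) w H) ∧
      |√Real.pi * localLip (gluedCurve f T L) w - cubicSpeed ‖w - latticePoint L n‖| ≤ 1 / 2 := by
  obtain ⟨v, hv, huv, hTn⟩ := hT.eq_smulRight n hn
  have hη : η ≤ 1 / 1000 := by nlinarith [hs.eta_mul_le, hs.two_lt, hs.eta_pos]
  have hL : 0 < L := by linarith [hs.sixteen_le]
  have htail := hs.tail_le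
  exact (hf.abs_localLip_gluedCurve_sub_cubicSpeed_le hn (by norm_num) (by norm_num) hs.eta_mul_le
    hT.norm_le hL hv huv hTn (by linarith [hs.radius_le]) (by linarith)
    (by linarith)).imp_right fun h => h.trans (by linarith)

theorem three_halves_le_sqrt_pi : 3 / 2 ≤ √Real.pi := by
  rw [Real.le_sqrt' (by norm_num)]
  linarith [Real.pi_gt_three]

theorem IsGluing.exists_lift_and_localLip_bounds (hT : IsGluing f r η L T)
    (hs : IsGluingScale δ r η L) (hδ1 : δ ≤ 1) (hf : IsHolomorphicCurve f)
    (hfδ : ∀ z, localLip f z ≤ 1 - δ) (w : ℂ) :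
    (∃ H, IsEuclideanLiftAt (gluedCurve f T L) w H) ∧
      localLip (gluedCurve f T L) w ≤ 1 ∧ localLip f w - δ ≤ localLip (gluedCurve f T L) w := by
  have hL : 0 < L := by linarith [hs.sixteen_le]
  have hδ : 0 < δ := hs.eta_pos.trans_le hs.eta_le
  have hwδ := hfδ w
  have hw1 : localLip f w ≤ 1 := by linarith
  have hw := norm_sub_latticePoint_nearestIndex_le hL w
  by_cases hn : IsSlowAt f r η L (nearestIndex L w)
  · rcases le_total ‖w - latticePoint L (nearestIndex L w)‖ r with hwr | hrw
    · obtain ⟨hlift, hspeed⟩ := hT.abs_localLip_sub_cubicSpeed_le hs hf hn hwr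
      have hslow := hn w (mem_ball_iff_norm.2 (by linarith))
      have hnonneg := localLip_nonneg (gluedCurve f T L) w
      refine ⟨hlift, ?_, by linarith [hs.eta_le]⟩
      nlinarith [(abs_le.1 hspeed).2, three_halves_le_sqrt_pi,
        cubicSpeed_le_one ‖w - latticePoint L (nearestIndex L w)‖]
    · obtain ⟨hlift, hspeed⟩ := hT.abs_localLip_sub_le_of_le_norm_sub hs hδ1 hf hw1 hrw hw
      obtain ⟨hlower, hupper⟩ := abs_le.1 hspeed
      exact ⟨hlift, by linarith, by linarith⟩
  · obtain ⟨hlift, hspeed⟩ := hT.abs_localLip_sub_le_of_not_isSlowAt hs hf hw1 hn hw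
    obtain ⟨hlower, hupper⟩ := abs_le.1 hspeed
    exact ⟨hlift, by linarith [hs.eta_le], by linarith [hs.eta_le]⟩

theorem IsGluing.exists_half_eta_le_localLip (hT : IsGluing f r η L T)
    (hs : IsGluingScale δ r η L) (hf : IsHolomorphicCurve f) (hf1 : ∀ z, localLip f z ≤ 1)
    (n : Fin 2 → ℤ) :
    ∃ z ∈ Metric.ball (latticePoint L n) (r + 2), η / 2 ≤ localLip (gluedCurve f T L) z := by
  by_cases hn : IsSlowAt f r η L n
  · have hdist : ‖latticePoint L n + 2 - latticePoint L n‖ = 2 := by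
      rw [add_sub_cancel_left, Complex.norm_ofNat]
    have hη : η ≤ 1 / 1000 := by nlinarith [hs.eta_mul_le, hs.two_lt, hs.eta_pos]
    obtain ⟨-, hspeed⟩ := hT.abs_localLip_sub_cubicSpeed_le hs hf hn
      (hdist.trans_le hs.two_lt.le)
    have hmodel : cubicSpeed 2 = 3 / 4 := by norm_num [cubicSpeed]
    rw [hdist, hmodel] at hspeed
    refine ⟨latticePoint L n + 2, mem_ball_iff_norm.2 (by linarith [hs.two_lt]), ?_⟩
    nlinarith [(abs_le.1 hspeed).1, sqrt_pi_le_two,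
      localLip_nonneg (gluedCurve f T L) (latticePoint L n + 2)]
  · have hfast := hn
    simp only [IsSlowAt, not_forall, not_le] at hfast
    obtain ⟨z, hz, hηz⟩ := hfast
    obtain ⟨-, hspeed⟩ := hT.abs_localLip_sub_le_of_not_isSlowAt hs hf (hf1 z) hn
      ((mem_ball_iff_norm.1 hz).le.trans hs.radius_le)
    exact ⟨z, hz, by linarith [(abs_le.1 hspeed).1]⟩

theorem IsGluing.isNondegenerate (hT : IsGluing f r η L T)
    (hs : IsGluingScale δ r η L) (hf : IsHolomorphicCurve f) (hf1 : ∀ z, localLip f z ≤ 1) :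
    IsNondegenerate (gluedCurve f T L) := by
  have hL : 0 < L := by linarith [hs.sixteen_le]
  have hη : 0 < 2 / η := div_pos two_pos hs.eta_pos
  refine ⟨2 * L + 2 / η, by positivity, fun a => ?_⟩
  obtain ⟨z, hz, hηz⟩ := hT.exists_half_eta_le_localLip hs hf hf1 (nearestIndex L a)
  have ha := norm_sub_latticePoint_nearestIndex_le hL a
  rw [norm_sub_rev] at ha
  refine ⟨z, mem_closedBall_iff_norm.2 ?_, le_trans ?_ hηz⟩
  · linarith [mem_ball_iff_norm.1 hz, hs.radius_le,
      norm_sub_le_norm_sub_add_norm_sub z (latticePoint L (nearestIndex L a)) a]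
  · rw [one_div, inv_le_comm₀ (by positivity) (half_pos hs.eta_pos), inv_div]
    linarith

end GluingScales

section Conclusion

variable {N : ℕ} {f : ℂ → CP N} {δ : ℝ}

theorem IsHolomorphicCurve.exists_isBrodyCurve_isNondegenerate (hN : 1 ≤ N)
    (hf : IsHolomorphicCurve f) (hδ : 0 < δ) (hδ1 : δ ≤ 1) (hfδ : ∀ z, localLip f z ≤ 1 - δ) :
    ∃ g : ℂ → CP N, IsBrodyCurve g ∧ IsNondegenerate g ∧
      ∀ z, localLip f z - δ ≤ localLip g z := by
  obtain ⟨r, η, L, hs⟩ := exists_isGluingScale hδ hδ1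
  obtain ⟨T, hT⟩ := exists_isGluing hN f r η L
  have hbounds := hT.exists_lift_and_localLip_bounds hs hδ1 hf hfδ
  exact ⟨gluedCurve f T L,
    ⟨isHolomorphicCurve_iff_exists_lift.2 fun w => (hbounds w).1, fun w => (hbounds w).2.1⟩,
    hT.isNondegenerate hs hf fun z => (hfδ z).trans (by linarith), fun w => (hbounds w).2.2⟩

theorem isLUB_energyDensityCP (N : ℕ) :
    IsLUB {r : ℝ | ∃ f : ℂ → CP N, IsBrodyCurve f ∧ energyDensity f = r} (energyDensityCP N) := by
  refine isLUB_csSup ⟨_, _, isBrodyCurve_const (Classical.arbitrary _), rfl⟩ ⟨1, ?_⟩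
  rintro _ ⟨f, hf, rfl⟩
  exact hf.energyDensity_le_one

theorem IsBrodyCurve.exists_isNondegenerate_energyDensity_sub_le (hN : 1 ≤ N)
    (hf : IsBrodyCurve f) (hδ : 0 < δ) (hδ1 : δ < 1) :
    ∃ g : ℂ → CP N, IsBrodyCurve g ∧ IsNondegenerate g ∧
      energyDensity f - 4 * δ ≤ energyDensity g := by
  have hc : 0 < 1 - δ := sub_pos.2 hδ1
  have hnorm : ‖((1 - δ : ℝ) : ℂ)‖ = 1 - δ := Complex.norm_of_nonneg hc.le
  have hfc := hf.comp_const_mul (hnorm.trans_le (by linarith))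
  obtain ⟨g, hg, hgn, hgf⟩ := hfc.1.exists_isBrodyCurve_isNondegenerate hN hδ hδ1.le fun z => by
    rw [hf.1.localLip_comp_const_mul, hnorm]
    exact mul_le_of_le_one_right hc.le (hf.2 _)
  refine ⟨g, hg, hgn, ?_⟩
  have hdensity := hfc.energyDensity_sub_le hg hδ.le hgf
  rw [hf.energyDensity_comp_const_mul hc (by linarith)] at hdensity
  have hscaled : energyDensity f - 2 * δ ≤ (1 - δ) ^ 2 * energyDensity f := by
    have hnonneg : 0 ≤ 2 * δ * (1 - energyDensity f) :=
      mul_nonneg (by linarith) (by linarith [hf.energyDensity_le_one])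
    nlinarith [sq_nonneg δ]
  linarith

end Conclusion

end

theorem mainTheorem9 (N : ℕ) (hN : 1 ≤ N) :
    (∀ f : ℂ → CP N, IsBrodyCurve f →
      Tendsto (maxMeanEnergy f) atTop (𝓝 (energyDensity f))) ∧
    IsLUB {r : ℝ | ∃ f : ℂ → CP N, IsBrodyCurve f ∧ energyDensity f = r} (energyDensityCP N) ∧
    ∀ ε : ℝ, 0 < ε →
      ∃ g : ℂ → CP N, IsBrodyCurve g ∧ IsNondegenerate g ∧
        energyDensityCP N - ε < energyDensity g := by
  refine ⟨fun f hf => hf.tendsto_maxMeanEnergy, isLUB_energyDensityCP N, fun ε hε => ?_⟩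
  obtain ⟨_, ⟨f, hf, rfl⟩, hfε, -⟩ :=
    (isLUB_energyDensityCP N).exists_between (sub_lt_self _ (half_pos hε))
  obtain ⟨δ, hδ, hδε⟩ : ∃ δ, 0 < δ ∧ δ < min (ε / 8) 1 := exists_between (by positivity)
  obtain ⟨hδε, hδ1⟩ := lt_min_iff.1 hδε
  obtain ⟨g, hg, hgn, hgf⟩ := hf.exists_isNondegenerate_energyDensity_sub_le hN hδ hδ1
  exact ⟨g, hg, hgn, by linarith⟩
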